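/- Let $G=U(n)$ and let $r=\frac12\sum_i e_{ii}\otimes e_{ii}+\sum_{i<j}e_{ij}\otimes e_{ji}$. Let $G^*$ be the real form $f^*=g^{-1}$ of the group of pairs $(g,f)$ of an upper triangular matrix $g$ and a lower triangular matrix $f$ in $\mathrm{GL}(n,\mathbb C)$ with mutually inverse diagonals, with the real Poisson bracket $\{\cdot,\cdot\}^{\mathbb R}=i\{\cdot,\cdot\}$, where $$\{g^1,g^2\}=[r,g^1g^2],\qquad \{f^1,f^2\}=[r,f^1f^2],\qquad \{g^1,f^2\}=[r,g^1f^2].$$ For $n\ge k\ge l\ge 1$ let $\Delta^{(k)}_l$ be the minor of $g$ formed by the rows $n-k+1,\dots,n-k+l$ and the last $l$ columns. The $\Delta^{(k)}_k$ are real on $G^*$; consider the chart where $\Delta^{(k)}_k>0$ for all $k$ and $\Delta^{(k)}_l\neq0$ for all $k>l$. On this chart the Poisson bracket of any two functions $u,v$ among the coordinates $\Delta^{(k)}_l$ ($k\ge l$) and the conjugates $\bar\Delta^{(k)}_l$ ($k>l$) is given by a unique Laurent polynomial in these coordinates and conjugates. Let $\mathcal C(\pi_{G^*};\Delta,\bar\Delta)\subset\mathbb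 R^{n(n+1)/2}$ be the open polyhedral cone of all $\zeta=(\zeta^{(k)}_l)_{n\ge k\ge l\ge1}$ such that, for all such $u,v$, every monomial that occurs in this Laurent polynomial with non-zero coefficient, other than the log-canonical monomial $uv$, has strictly smaller exponent than $uv$; here $\Delta^{(k)}_l$ and $\bar\Delta^{(k)}_l$ both have exponent $\zeta^{(k)}_l$, and the exponent of a Laurent monomial is the corresponding linear form in $\zeta$. Let $\mathcal C_{GZ}\subset\mathbb R^{n(n+1)/2}$ be the open Gelfand–Zeitlin cone of all $(\lambda^{(k)}_l)_{n\ge k\ge l\ge1}$ with $$\lambda^{(k)}_l>\lambda^{(k-1)}_l>\lambda^{(k)}_{l+1}\qquad(2\le k\le n,\ 1\le l\le k-1).$$ Theorem. The formula $\zeta^{(k)}_l=\lambda^{(k)}_1+\dots+\lambda^{(k)}_l$ defines a linear isomorphism $\sigma$ of $\mathbb R^{n(n+1)/2}$ onto itself, and $\sigma(\mathcal C_{GZ})=\mathcal C(\pi_{G^*};\Delta,\bar\Delta)$. -/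

import Mathlib

open scoped Kronecker Matrix

noncomputable section

/-! ## Laurent polynomials and the tropical cone

Coordinates on a real Poisson manifold are indexed by a finite type `ι`; those satisfying the
predicate `R` are real positive (the `x_i`), the others are complex and nonvanishing (the `z_a`). -/

/-- The coordinate functions together with the complex conjugates of the complex ones:
`inl i` stands for `x_i` or `z_i`, and `inr a` for the conjugate of `z_a`. -/
abbrev Coord (ι : Type) (R : ι → Prop) : Type := ι ⊕ {a : ι // ¬ R a}

/-- The index of the coordinate that a member of `Coord ι R` comes from. -/
def Coord.idx {ι : Type} {R : ι → Prop} : Coord ι R → ι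
  | Sum.inl i => i
  | Sum.inr a => a.1

/-- Values of `x_i, z_a` and of the conjugates of `z_a`, given the values of `x_i, z_a`. -/
def Coord.val {ι : Type} {R : ι → Prop} (y : ι → ℂ) : Coord ι R → ℂ
  | Sum.inl i => y i
  | Sum.inr a => (starRingEnd ℂ) (y a.1)

/-- Complex Laurent polynomials in a family of variables indexed by `V`. -/
abbrev LaurentPoly (V : Type) : Type := AddMonoidAlgebra ℂ (V → ℤ)

/-- The value of a Laurent polynomial at a point with nonzero coordinates. -/
def LaurentPoly.eval {V : Type} [Fintype V] (p : LaurentPoly V) (y : V → ℂ) : ℂ :=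
  p.coeff.sum fun m c => c * ∏ v, y v ^ m v

/-- On the chart `U` with coordinates `y`, the brackets `br u v` of all pairs of functions among
`x_i`, `z_a` and the conjugates of `z_a` are given by the Laurent polynomials `P u v` in
`x`, `z` and the conjugates of `z`. -/
def IsLaurentBracket {X ι : Type} [Fintype ι] {R : ι → Prop} [DecidablePred R]
    (U : Set X) (y : X → ι → ℂ) (br : Coord ι R → Coord ι R → X → ℂ)
    (P : Coord ι R → Coord ι R → LaurentPoly (Coord ι R)) : Prop :=
  ∀ u v, ∀ p ∈ U, br u v p = (P u v).eval (Coord.val (y p))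

/-- The exponent of the log-canonical monomial in the bracket of the coordinates `u` and `v`,
that is, of the product of `u` and `v`. -/
def logCanonicalExponent {V : Type} [DecidableEq V] (u v : V) : V → ℤ :=
  Pi.single u 1 + Pi.single v 1

/-- The tropical cone of a bracket with Laurent coefficients `P`. Every term of `P u v` other than
the log-canonical one (the multiple of the product of `u` and `v`) gives one strict inequality.
A coordinate and its conjugate scale with the same exponent `ξ i`. Swapping the two entries of
a bracket, or conjugating both, repeats the same inequality, so all pairs may be listed. -/
def tropicalCone {ι : Type} [Fintype ι] [DecidableEq ι] {R : ι → Prop} [DecidablePred R]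
    (P : Coord ι R → Coord ι R → LaurentPoly (Coord ι R)) : Set (ι → ℝ) :=
  {ξ | ∀ u v, ∀ m ∈ (P u v).coeff.support, m ≠ logCanonicalExponent u v →
    ∑ w, (m w : ℝ) * ξ w.idx < ξ u.idx + ξ v.idx}

/-! ## The Poisson-Lie group dual to `U(n)` -/

/-- Square complex matrices of size `n`. -/
abbrev Mat (n : ℕ) : Type := Matrix (Fin n) (Fin n) ℂ

/-- The standard `r`-matrix
`r = 1/2 ∑ i, e_ii ⊗ e_ii + ∑ i < j, e_ij ⊗ e_ji`. -/
def rMatrix (n : ℕ) : Matrix (Fin n × Fin n) (Fin n × Fin n) ℂ :=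
  (1 / 2 : ℂ) • ∑ i : Fin n, Matrix.single i i (1 : ℂ) ⊗ₖ Matrix.single i i (1 : ℂ) +
    ∑ i : Fin n, ∑ j : Fin n,
      if i < j then Matrix.single i j (1 : ℂ) ⊗ₖ Matrix.single j i (1 : ℂ) else 0

/-- The commutator `[r, A¹ B²] = r A¹ B² - A¹ B² r`, where `A¹ = A ⊗ 1` and `B² = 1 ⊗ B`. -/
def rCommutator {n : ℕ} (A B : Mat n) : Matrix (Fin n × Fin n) (Fin n × Fin n) ℂ :=
  rMatrix n * ((A ⊗ₖ (1 : Mat n)) * ((1 : Mat n) ⊗ₖ B)) -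
    ((A ⊗ₖ (1 : Mat n)) * ((1 : Mat n) ⊗ₖ B)) * rMatrix n

/-- The partial derivative of `F (g, f)` in the entry `g i j`. -/
def derivG {n : ℕ} (F : Mat n × Mat n → ℂ) (p : Mat n × Mat n) (i j : Fin n) : ℂ :=
  deriv (fun t : ℂ => F (p.1 + t • Matrix.single i j (1 : ℂ), p.2)) 0

/-- The partial derivative of `F (g, f)` in the entry `f i j`. -/
def derivF {n : ℕ} (F : Mat n × Mat n → ℂ) (p : Mat n × Mat n) (i j : Fin n) : ℂ :=
  deriv (fun t : ℂ => F (p.1, p.2 + t • Matrix.single i j (1 : ℂ))) 0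

/-- The complex Poisson bracket of two functions of `(g, f)`, determined by
`{g¹, g²} = [r, g¹ g²]`, `{f¹, f²} = [r, f¹ f²]`, `{g¹, f²} = [r, g¹ f²]`
and the Leibniz rule: the bracket of the entries `(i, j)` and `(s, t)` is the entry
`((i, s), (j, t))` of the right-hand side, and `{f_ij, g_st} = - {g_st, f_ij}`.
It is written in the entries of `g` and `f` and is tangent to the subgroup
of pairs of an upper and a lower triangular matrix with mutually inverse diagonals. -/
def complexBracket {n : ℕ} (F H : Mat n × Mat n → ℂ) (p : Mat n × Mat n) : ℂ :=
  ∑ i : Fin n, ∑ j : Fin n, ∑ s : Fin n, ∑ t : Fin n,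
    (derivG F p i j * derivG H p s t * rCommutator p.1 p.1 (i, s) (j, t) +
      derivF F p i j * derivF H p s t * rCommutator p.2 p.2 (i, s) (j, t) +
      derivG F p i j * derivF H p s t * rCommutator p.1 p.2 (i, s) (j, t) -
      derivF F p i j * derivG H p s t * rCommutator p.1 p.2 (s, i) (t, j))

/-- The real Poisson bracket `{·, ·}^ℝ = i {·, ·}` of `G^*` for `G = U(n)`. -/
def realBracket {n : ℕ} (F H : Mat n × Mat n → ℂ) (p : Mat n × Mat n) : ℂ :=
  Complex.I * complexBracket F H p

/-- The real form `f^* = g⁻¹` of the group of pairs `(g, f)` with `g` upper triangular,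
`f` lower triangular and `g_d f_d = 1`. -/
def dualGroup (n : ℕ) : Set (Mat n × Mat n) :=
  {p | (∀ i j, j < i → p.1 i j = 0) ∧ (∀ i j, i < j → p.2 i j = 0) ∧
    (∀ i, p.1 i i * p.2 i i = 1) ∧ p.2ᴴ = p.1⁻¹}

/-! ## Solid minors as coordinates -/

/-- Index set of the pairs `n ≥ k ≥ l ≥ 1`; the element `⟨a, b⟩` stands for
`k = a + 1` and `l = b + 1`. -/
abbrev GZIndex (n : ℕ) : Type := (a : Fin n) × Fin (a.val + 1)

/-- The pairs with `k = l`, for which the coordinate is real. -/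
def IsRealIdx {n : ℕ} (c : GZIndex n) : Prop := c.2.val = c.1.val

instance {n : ℕ} : DecidablePred (@IsRealIdx n) :=
  fun c => inferInstanceAs (Decidable (c.2.val = c.1.val))

/-- The labels `n-k+1, …, n-k+l` (counted from `1`). -/
def solidRow {n : ℕ} (c : GZIndex n) (a : Fin (c.2.val + 1)) : Fin n :=
  ⟨n - (c.1.val + 1) + a.val, by have := c.1.isLt; have := c.2.isLt; have := a.isLt; omega⟩

/-- The last `l` labels `n-l+1, …, n` (counted from `1`). -/
def solidCol {n : ℕ} (c : GZIndex n) (a : Fin (c.2.val + 1)) : Fin n :=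
  ⟨n - (c.2.val + 1) + a.val, by have := c.1.isLt; have := c.2.isLt; have := a.isLt; omega⟩

/-- The minor `Δ^(k)_l` of `g`: rows `n-k+1, …, n-k+l` and the last `l` columns. -/
def solidMinor {n : ℕ} (g : Mat n) (c : GZIndex n) : ℂ :=
  (g.submatrix (solidRow c) (solidCol c)).det

/-- The minor `Λ^(k)_l` of `f⁻¹`: the last `l` rows and columns `n-k+1, …, n-k+l`. -/
def dualMinor {n : ℕ} (f : Mat n) (c : GZIndex n) : ℂ :=
  ((f⁻¹).submatrix (solidCol c) (solidRow c)).det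

/-- On the real form, `Λ^(k)_l` is the complex conjugate of `Δ^(k)_l`. -/
theorem dualMinor_eq_conj {n : ℕ} {p : Mat n × Mat n} (hp : p ∈ dualGroup n) (c : GZIndex n) :
    dualMinor p.2 c = (starRingEnd ℂ) (solidMinor p.1 c) := by
  obtain ⟨hu, -, hd, h⟩ := hp
  have hdet : IsUnit p.1.det := by
    rw [Matrix.det_of_isUpperTriangular (M := p.1) (fun i j hij => hu i j hij)]
    exact isUnit_iff_ne_zero.mpr
      (Finset.prod_ne_zero_iff.mpr fun i _ => left_ne_zero_of_mul (b := p.2 i i) (by simp [hd i]))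
  have h2 : (p.2)⁻¹ = p.1ᴴ := by
    have h3 : p.2 = (p.1⁻¹)ᴴ := by rw [← h, Matrix.conjTranspose_conjTranspose]
    rw [h3, ← Matrix.conjTranspose_nonsing_inv, Matrix.nonsing_inv_nonsing_inv _ hdet]
  unfold dualMinor solidMinor
  rw [h2, ← Matrix.conjTranspose_submatrix, Matrix.det_conjTranspose]
  rfl

/-- The functions `Δ^(k)_l` (for `k ≥ l`) and `Λ^(k)_l`, the conjugate of `Δ^(k)_l` on the
real form (for `k > l`), as functions of `(g, f)`. -/
def coordFun {n : ℕ} : Coord (GZIndex n) IsRealIdx → Mat n × Mat n → ℂ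
  | Sum.inl c => fun p => solidMinor p.1 c
  | Sum.inr c => fun p => dualMinor p.2 c.1

/-- The coordinate chart of `G^*` where all `Δ^(k)_k` are positive and no `Δ^(k)_l` vanishes. -/
def minorChart (n : ℕ) : Set (Mat n × Mat n) :=
  {p | p ∈ dualGroup n ∧ (∀ c, IsRealIdx c → ∃ x : ℝ, 0 < x ∧ solidMinor p.1 c = x) ∧
    ∀ c, solidMinor p.1 c ≠ 0}

/-- `P` is the table of Laurent expansions of the real Poisson bracket of `G^*` in the
coordinates `Δ^(k)_l` and their conjugates. -/
def IsDualGroupLaurentBracket (n : ℕ)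
    (P : Coord (GZIndex n) IsRealIdx → Coord (GZIndex n) IsRealIdx →
      LaurentPoly (Coord (GZIndex n) IsRealIdx)) : Prop :=
  IsLaurentBracket (minorChart n) (fun p c => solidMinor p.1 c)
    (fun u v p => realBracket (coordFun u) (coordFun v) p) P

/-! ## The Gelfand-Zeitlin cone -/

/-- The open Gelfand-Zeitlin cone: the strict interlacing inequalities
`λ^(k)_l > λ^(k-1)_l > λ^(k)_(l+1)` for `2 ≤ k ≤ n` and `1 ≤ l ≤ k-1`
(below, `a + 2` is `k` and `b + 1` is `l`). -/
def gzCone (n : ℕ) : Set (GZIndex n → ℝ) :=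
  {lam | ∀ (a : ℕ) (ha : a + 1 < n) (b : ℕ) (hb : b < a + 1),
    lam ⟨⟨a, by omega⟩, ⟨b, hb⟩⟩ < lam ⟨⟨a + 1, ha⟩, ⟨b, by simp only; omega⟩⟩ ∧
    lam ⟨⟨a + 1, ha⟩, ⟨b + 1, by simp only; omega⟩⟩ < lam ⟨⟨a, by omega⟩, ⟨b, hb⟩⟩}

end

/-! Index rows and columns of `g` from the last one, starting at `0`; then `g` is lower triangular
and the minor `(k, l)` uses the rows `k - l, …, k` and the columns `0, …, l`. Neville elimination,
which subtracts multiples of neighbouring rows, turns the rows into `ρ k l` with zeros in the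
columns before `l`, and the minor `(k, l)` is up to sign the product of the pivots `ρ k j j`, `j ≤
l` (`IsNeville.det_eq`). So a pivot is up to sign a ratio of consecutive minors, and its tropical
weight is the difference `idxDiff ξ k l`, which is the Gelfand–Zeitlin coordinate `λ`. The
multiplier `ρ k l l / ρ (k+1) l l` has weight `λ (k, l) - λ (k+1, l)`, and the ratio of the pivots
`(k+1, l+1)` and `(k, l)` has weight `λ (k+1, l+1) - λ (k, l)`. The interlacing inequalities say
exactly that all these Laurent monomials have negative weight.

Running the elimination backwards shows that the minors take arbitrary nonzero values on the chart,
apart from positivity of the real ones. Laurent monomials are therefore pulled back to distinct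
characters of a torus and are linearly independent (`linearIndependent_chartMonomial`). This gives
uniqueness of the expansions and lets coefficients be read off.

A bracket divided by the product of its two arguments pairs, through `r`, the matrices `rowMat = g *
logGrad` and `colMat = logGrad * g`. Two holomorphic or two antiholomorphic minors are
log-canonical: the off-diagonal products vanish, or sit on one side of the diagonal and add up to a
constant trace (`exists_rForm_sub_eq`). In a mixed bracket the non-constant terms are sums of `M s i
* conj (N s i)` over `i < s`, with a plus sign for `colMat` and a minus sign for `rowMat`
(`mixed_eq`). The off-diagonal entries of `rowMat` are polynomials without constant term in the
multipliers, those of `colMat` in the pivot ratios. Interlacing thus makes every correction strictly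
smaller (`exists_chartBracket_sub_mem`), which is one inclusion.

For the other inclusion each interlacing inequality must come from a term that really occurs. In the
bracket of the minor `(k+1, l)` with its conjugate, the square modulus of the multiplier `(k, l)`,
or of the pivot ratio `(k, l)`, should appear with coefficient `-i`, or `i`, times the log-canonical
monomial. To exclude cancellation, take a weight in the relative interior of the corresponding
facet: that monomial then has weight zero, every other correction has negative weight, and linear
independence isolates the coefficient (`coeff_ne_zero_of_facet`). -/

noncomputable section

/-! ## Neville elimination -/

/-- The coefficients of the rows `k - l, …, k` in the row `ρ k l` produced by Neville elimination
with multipliers `A`. -/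
def nevilleCoeff (A : ℕ → ℕ → ℂ) : ℕ → ℕ → ℕ → ℂ
  | _, 0, e => if e = 0 then 1 else 0
  | 0, _ + 1, _ => 0
  | k + 1, l + 1, 0 => nevilleCoeff A k l 0
  | k + 1, l + 1, e + 1 => nevilleCoeff A k l (e + 1) - A k l * nevilleCoeff A (k + 1) l e

theorem nevilleCoeff_zero (A : ℕ → ℕ → ℂ) {k l : ℕ} (h : l ≤ k) : nevilleCoeff A k l 0 = 1 := by
  induction l generalizing k with
  | zero => simp [nevilleCoeff]
  | succ l ih =>
    obtain ⟨k, rfl⟩ := Nat.exists_eq_succ_of_ne_zero (show k ≠ 0 by omega)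
    simpa [nevilleCoeff] using ih (by omega)

theorem nevilleCoeff_of_lt (A : ℕ → ℕ → ℂ) {k l e : ℕ} (h : l < e) :
    nevilleCoeff A k l e = 0 := by
  induction l generalizing k e with
  | zero => simp [nevilleCoeff, show e ≠ 0 by omega]
  | succ l ih =>
    obtain ⟨e, rfl⟩ := Nat.exists_eq_succ_of_ne_zero (show e ≠ 0 by omega)
    cases k with
    | zero => simp [nevilleCoeff]
    | succ k => simp [nevilleCoeff, ih (show l < e + 1 by omega), ih (show l < e by omega)]

/-- The rows `ρ k l` are obtained from the rows `ρ k 0` by Neville elimination with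
multipliers `A`. -/
def IsNeville (A : ℕ → ℕ → ℂ) (ρ : ℕ → ℕ → ℕ → ℂ) : Prop :=
  ∀ k l c, l ≤ k → ρ (k + 1) (l + 1) c = ρ k l c - A k l * ρ (k + 1) l c

theorem IsNeville.eq_sum {A : ℕ → ℕ → ℂ} {ρ : ℕ → ℕ → ℕ → ℂ} (h : IsNeville A ρ) {k l : ℕ}
    (hl : l ≤ k) (c : ℕ) :
    ρ k l c = ∑ e ∈ Finset.range (l + 1), nevilleCoeff A k l e * ρ (k - l + e) 0 c := by
  induction l generalizing k with
  | zero => simp [nevilleCoeff]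
  | succ l ih =>
    obtain ⟨k, rfl⟩ := Nat.exists_eq_succ_of_ne_zero (show k ≠ 0 by omega)
    rw [Nat.succ_eq_add_one, h k l c (by omega), ih (by omega), ih (by omega),
      Finset.sum_range_succ' _ (l + 1), show k + 1 - (l + 1) + 0 = k - l by omega,
      Finset.sum_range_succ' _ l, nevilleCoeff_zero A (show l ≤ k by omega),
      nevilleCoeff_zero A hl]
    have e1 : ∀ e, k + 1 - l + e = k + 1 - (l + 1) + (e + 1) := fun e => by omega
    simp only [nevilleCoeff, sub_mul, Finset.sum_sub_distrib, Finset.mul_sum, e1, mul_assoc]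
    rw [Finset.sum_range_succ (fun e => nevilleCoeff A k l (e + 1) * _) l,
      nevilleCoeff_of_lt A (show l < l + 1 by omega)]
    simp only [show ∀ e, k - l + (e + 1) = k + 1 - (l + 1) + (e + 1) from fun e => by omega,
      zero_mul, add_zero, one_mul]
    ring

/-- The rows `ρ k 0, …, ρ k l` arise from the original rows `k, k - 1, …, k - l` by the
unitriangular matrix `W` of Neville coefficients, and under `h0` they form a triangular matrix with
the pivots on the diagonal. -/
theorem IsNeville.det_eq {A : ℕ → ℕ → ℂ} {ρ : ℕ → ℕ → ℕ → ℂ} (h : IsNeville A ρ) {k l : ℕ}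
    (hl : l ≤ k) (h0 : ∀ s ≤ l, ∀ t < s, ρ k s t = 0) :
    (Matrix.of fun s t : Fin (l + 1) => ρ (k - s) 0 t).det =
      ∏ j ∈ Finset.range (l + 1), ρ k j j := by
  let W : Matrix (Fin (l + 1)) (Fin (l + 1)) ℂ :=
    Matrix.of fun s s' => if (s' : ℕ) ≤ s then nevilleCoeff A k s (s - s') else 0
  have hW : W.det = 1 := by
    rw [Matrix.det_of_isLowerTriangular]
    · refine Finset.prod_eq_one fun s _ => ?_
      simp only [W, Matrix.of_apply, le_refl, if_true, Nat.sub_self]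
      exact nevilleCoeff_zero A (by have := s.isLt; omega)
    · intro s s' hs
      have : ¬ (s' : ℕ) ≤ s := not_le.mpr hs
      simp only [W, Matrix.of_apply, if_neg this]
  have hmul : W * (Matrix.of fun s t : Fin (l + 1) => ρ (k - s) 0 t) =
      Matrix.of fun s t : Fin (l + 1) => ρ k s t := by
    ext s t
    have hs := s.isLt
    rw [Matrix.mul_apply, Matrix.of_apply, h.eq_sum (show (s : ℕ) ≤ k by omega),
      ← Finset.sum_range_reflect]
    simp only [W, Matrix.of_apply]
    rw [Fin.sum_univ_eq_sum_range (fun x => (if x ≤ (s : ℕ) then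
      nevilleCoeff A k s (s - x) else 0) * ρ (k - x) 0 t) (l + 1)]
    rw [← Finset.sum_subset (Finset.range_mono (show (s : ℕ) + 1 ≤ l + 1 by omega))]
    · refine Finset.sum_congr rfl fun x hx => ?_
      have hx : x < s + 1 := Finset.mem_range.mp hx
      rw [if_pos (by omega), show (s : ℕ) + 1 - 1 - x = s - x by omega,
        show k - (s : ℕ) + (s - x) = k - x by omega]
    · intro x _ hx
      have hx : ¬ x < s + 1 := fun h => hx (Finset.mem_range.mpr h)
      rw [if_neg (by omega), zero_mul]
  have := congrArg Matrix.det hmul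
  rw [Matrix.det_mul, hW, one_mul] at this
  rw [this, Matrix.det_of_isUpperTriangular,
    ← Fin.prod_univ_eq_prod_range (fun j => ρ k j j) (l + 1)]
  · rfl
  · intro s t hst
    exact h0 s (by have := s.isLt; omega) t hst

/-- The entries of a matrix, with rows and columns counted from the last one. -/
def revEntry {n : ℕ} (g : Mat n) (k c : ℕ) : ℂ :=
  if h : k < n ∧ c < n then g ⟨n - 1 - k, by omega⟩ ⟨n - 1 - c, by omega⟩ else 0

theorem revEntry_rev {n : ℕ} (g : Mat n) (i j : Fin n) :
    revEntry g (n - 1 - i) (n - 1 - j) = g i j := by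
  have hi := i.isLt
  have hj := j.isLt
  rw [revEntry, dif_pos ⟨by omega, by omega⟩]
  congr 1 <;> ext <;> simp only <;> omega

/-- The sign of the order-reversing permutation. -/
def revSign (l : ℕ) : ℂ := ((Equiv.Perm.sign (Fin.revPerm : Equiv.Perm (Fin (l + 1))) : ℤ) : ℂ)

theorem revSign_mul_self (l : ℕ) : revSign l * revSign l = 1 := by
  unfold revSign
  rcases Int.units_eq_one_or (Equiv.Perm.sign (Fin.revPerm : Equiv.Perm (Fin (l + 1)))) with h | h
    <;> simp [h]

theorem revSign_ne_zero (l : ℕ) : revSign l ≠ 0 :=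
  left_ne_zero_of_mul (b := revSign l) (by simp [revSign_mul_self])

theorem conj_revSign (l : ℕ) : (starRingEnd ℂ) (revSign l) = revSign l := by
  unfold revSign
  exact map_intCast _ _

theorem apply_solidRow_solidCol {n : ℕ} (g : Mat n) (c : GZIndex n) (a b : Fin (c.2.val + 1)) :
    g (solidRow c a) (solidCol c b) = revEntry g (c.1 - a) (c.2 - b) := by
  have h1 := c.1.isLt
  have h2 := c.2.isLt
  have ha := a.isLt
  have hb := b.isLt
  refine (revEntry_rev g _ _).symm.trans ?_
  congr 1 <;> simp only [solidRow, solidCol] <;> omega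

/-- In reversed indices the rows of the minor already descend from `k`, but its columns descend too;
reversing the columns costs `revSign`. -/
theorem solidMinor_eq_det {n : ℕ} (g : Mat n) (c : GZIndex n) :
    solidMinor g c = revSign c.2 *
      (Matrix.of fun s t : Fin (c.2.val + 1) => revEntry g (c.1 - s) t).det := by
  unfold revSign
  rw [← Matrix.det_permute', solidMinor]
  congr 1
  ext a b
  refine (apply_solidRow_solidCol g c a b).trans ?_
  simp only [Matrix.submatrix_apply, id, Matrix.of_apply, Fin.revPerm_apply, Fin.val_rev]
  congr 1
  omega

theorem IsNeville.solidMinor_eq {n : ℕ} {g : Mat n} {A : ℕ → ℕ → ℂ} {ρ : ℕ → ℕ → ℕ → ℂ}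
    (h : IsNeville A ρ) (hρ : ∀ k < n, ∀ c, ρ k 0 c = revEntry g k c) {k l : ℕ} (hk : k < n)
    (hl : l < k + 1) (h0 : ∀ s ≤ l, ∀ t < s, ρ k s t = 0) :
    solidMinor g ⟨⟨k, hk⟩, ⟨l, hl⟩⟩ = revSign l * ∏ j ∈ Finset.range (l + 1), ρ k j j := by
  rw [solidMinor_eq_det, ← h.det_eq (by omega) h0]
  congr 3
  ext s t
  exact (hρ (k - s) (by omega) t).symm

/-- The rows produced by Neville elimination in the rows of `G`. -/
def nevilleRow (G : ℕ → ℕ → ℂ) : ℕ → ℕ → ℕ → ℂ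
  | k, 0 => G k
  | 0, _ + 1 => 0
  | k + 1, l + 1 => fun c => nevilleRow G k l c -
      nevilleRow G k l l / nevilleRow G (k + 1) l l * nevilleRow G (k + 1) l c

/-- The multipliers of Neville elimination in the rows of `G`. -/
def nevilleMul (G : ℕ → ℕ → ℂ) (k l : ℕ) : ℂ := nevilleRow G k l l / nevilleRow G (k + 1) l l

theorem isNeville_nevilleRow (G : ℕ → ℕ → ℂ) : IsNeville (nevilleMul G) (nevilleRow G) := by
  intro k l c _
  simp [nevilleRow, nevilleMul]

theorem nevilleRow_eq_zero_of_gt {n : ℕ} {G : ℕ → ℕ → ℂ}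
    (hG : ∀ k c, k < n → k < c → G k c = 0) {k l c : ℕ} (hk : k < n) (hc : k < c) :
    nevilleRow G k l c = 0 := by
  induction l generalizing k c with
  | zero => simpa [nevilleRow] using hG k c hk hc
  | succ l ih =>
    cases k with
    | zero => simp [nevilleRow]
    | succ k => simp [nevilleRow, ih (show k < n by omega) (show k < c by omega), ih hk hc]

/-- Elimination never breaks down on the chart. Vanishing before column `l` needs only the earlier
pivots to be nonzero; the new pivot is then a factor of the nonvanishing minor `(k, l)`. -/
theorem nevilleRow_revEntry {n : ℕ} {g : Mat n} (hg : ∀ c, solidMinor g c ≠ 0) {l : ℕ} :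
    ∀ {k : ℕ} (_ : k < n) (_ : l ≤ k),
      (∀ t < l, nevilleRow (revEntry g) k l t = 0) ∧ nevilleRow (revEntry g) k l l ≠ 0 := by
  induction l using Nat.strong_induction_on with
  | _ l ih =>
    intro k hk hl
    have h0 : ∀ t < l, nevilleRow (revEntry g) k l t = 0 := by
      intro t ht
      obtain ⟨l, rfl⟩ := Nat.exists_eq_succ_of_ne_zero (show l ≠ 0 by omega)
      obtain ⟨k, rfl⟩ := Nat.exists_eq_succ_of_ne_zero (show k ≠ 0 by omega)
      have h1 := ih l (by omega) (k := k) (by omega) (by omega)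
      have h2 := ih l (by omega) (k := k + 1) (by omega) (by omega)
      simp only [nevilleRow]
      rcases Nat.lt_succ_iff_lt_or_eq.mp ht with h | rfl
      · simp [h1.1 t h, h2.1 t h]
      · rw [div_mul_cancel₀ _ h2.2, sub_self]
    refine ⟨h0, ?_⟩
    have h3 := (isNeville_nevilleRow (revEntry g)).solidMinor_eq (g := g)
      (fun k _ c => by simp [nevilleRow]) hk (show l < k + 1 by omega) (fun s hs t ht => by
        rcases hs.lt_or_eq with h | rfl
        · exact (ih s h hk (by omega)).1 t ht
        · exact h0 t ht)
    have h4 := hg ⟨⟨k, hk⟩, ⟨l, Nat.lt_succ_of_le hl⟩⟩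
    rw [h3] at h4
    exact Finset.prod_ne_zero_iff.mp (right_ne_zero_of_mul h4) l
      (Finset.mem_range.mpr (Nat.lt_succ_self l))

theorem solidMinor_eq_prod_nevilleRow {n : ℕ} {g : Mat n} (hg : ∀ c, solidMinor g c ≠ 0)
    {k l : ℕ} (hk : k < n) (hl : l < k + 1) :
    solidMinor g ⟨⟨k, hk⟩, ⟨l, hl⟩⟩ =
      revSign l * ∏ j ∈ Finset.range (l + 1), nevilleRow (revEntry g) k j j :=
  (isNeville_nevilleRow (revEntry g)).solidMinor_eq (fun k _ c => by simp [nevilleRow]) hk hl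
    fun _ hs t ht => (nevilleRow_revEntry hg hk (by omega)).1 t ht

/-- The rows obtained by inverting Neville elimination, from the pivots `ψ k l`. -/
def invNevilleRow (ψ : ℕ → ℕ → ℂ) : ℕ → ℕ → ℕ → ℂ := fun k l c =>
  if l < k then
    ψ k l / ψ (k - 1) l * (invNevilleRow ψ (k - 1) l c - invNevilleRow ψ k (l + 1) c)
  else if c = k then ψ k k else 0
termination_by k l => k - l

theorem invNevilleRow_of_lt (ψ : ℕ → ℕ → ℂ) {k l : ℕ} (h : l ≤ k) (c : ℕ) :
    invNevilleRow ψ (k + 1) l c =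
      ψ (k + 1) l / ψ k l * (invNevilleRow ψ k l c - invNevilleRow ψ (k + 1) (l + 1) c) := by
  rw [invNevilleRow, if_pos (by omega)]
  simp

theorem invNevilleRow_self (ψ : ℕ → ℕ → ℂ) (k c : ℕ) :
    invNevilleRow ψ k k c = if c = k then ψ k k else 0 := by
  rw [invNevilleRow, if_neg (by omega)]

theorem isNeville_invNevilleRow {ψ : ℕ → ℕ → ℂ} (hψ : ∀ k l, ψ k l ≠ 0) :
    IsNeville (fun k l => ψ k l / ψ (k + 1) l) (invNevilleRow ψ) := by
  intro k l c hl
  rw [invNevilleRow_of_lt ψ hl]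
  have := hψ k l
  have := hψ (k + 1) l
  field_simp
  ring

/-- Induction on the distance to the seed row `ρ k k`, which is supported in column `k` alone. Each
step backwards combines two rows supported in `l, …, k`, and only the first of them meets column
`l`. -/
theorem invNevilleRow_props {ψ : ℕ → ℕ → ℂ} (hψ : ∀ k l, ψ k l ≠ 0) (d : ℕ) :
    ∀ k l, k = l + d → (∀ c, c < l ∨ k < c → invNevilleRow ψ k l c = 0) ∧
      invNevilleRow ψ k l l = ψ k l := by
  induction d with
  | zero =>
    rintro k l rfl
    simp only [invNevilleRow_self, if_true, and_true]
    intro c hc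
    rw [if_neg (by omega)]
  | succ d ih =>
    rintro k l rfl
    obtain ⟨h1, h2⟩ := ih (l + d) l rfl
    obtain ⟨h3, -⟩ := ih (l + d + 1) (l + 1) (by omega)
    rw [← add_assoc]
    refine ⟨fun c hc => ?_, ?_⟩
    · rw [invNevilleRow_of_lt ψ (by omega), h1 c (by omega), h3 c (by omega)]
      simp
    · rw [invNevilleRow_of_lt ψ (by omega), h2, h3 l (by omega), sub_zero,
        div_mul_cancel₀ _ (hψ _ _)]

/-! ## The chart -/

theorem solidMinor_self_eq_prod {n : ℕ} {g : Mat n} (hg : ∀ i j, j < i → g i j = 0) {k : ℕ}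
    (hk : k < n) :
    solidMinor g ⟨⟨k, hk⟩, ⟨k, Nat.lt_succ_self k⟩⟩ =
      ∏ j ∈ Finset.range (k + 1), revEntry g j j := by
  unfold solidMinor
  rw [Matrix.det_of_isUpperTriangular]
  · rw [← Finset.prod_range_reflect]
    rw [← Fin.prod_univ_eq_prod_range
      (fun j => revEntry g (k + 1 - 1 - j) (k + 1 - 1 - j)) (k + 1)]
    exact Finset.prod_congr rfl fun a _ => apply_solidRow_solidCol g _ a a
  · intro a b hab
    refine hg _ _ ?_
    have hab : (b : ℕ) < a := hab
    simp only [Fin.lt_def, solidRow, solidCol]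
    omega

theorem revEntry_self_pos {n : ℕ} {g : Mat n} (hg : ∀ i j, j < i → g i j = 0)
    (h : ∀ c, IsRealIdx c → ∃ x : ℝ, 0 < x ∧ solidMinor g c = x) {k : ℕ} (hk : k < n) :
    ∃ x : ℝ, 0 < x ∧ revEntry g k k = x := by
  obtain ⟨x, hx, hxe⟩ := h ⟨⟨k, hk⟩, ⟨k, Nat.lt_succ_self k⟩⟩ rfl
  rw [solidMinor_self_eq_prod hg hk, Finset.prod_range_succ] at hxe
  cases k with
  | zero => exact ⟨x, hx, by simpa using hxe⟩
  | succ k =>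
    obtain ⟨y, hy, hye⟩ := h ⟨⟨k, by omega⟩, ⟨k, Nat.lt_succ_self k⟩⟩ rfl
    rw [solidMinor_self_eq_prod hg (by omega)] at hye
    refine ⟨x / y, div_pos hx hy, ?_⟩
    have hy0 : (y : ℂ) ≠ 0 := by exact_mod_cast hy.ne'
    rw [hye] at hxe
    push_cast
    rw [eq_div_iff hy0, ← hxe, mul_comm]

/-- The conjugate transpose of `g⁻¹` has diagonal entries conjugate to the inverses of those of `g`;
reality of the diagonal makes them true inverses. -/
theorem mem_dualGroup_of_upperTriangular {n : ℕ} {g : Mat n} (hg : ∀ i j, j < i → g i j = 0)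
    (hd : ∀ i, ∃ x : ℝ, 0 < x ∧ g i i = x) : (g, (g⁻¹)ᴴ) ∈ dualGroup n := by
  have hU : g.IsUpperTriangular := fun i j hij => hg i j hij
  have hdet : IsUnit g.det := by
    rw [Matrix.det_of_isUpperTriangular hU, isUnit_iff_ne_zero]
    refine Finset.prod_ne_zero_iff.mpr fun i _ => ?_
    obtain ⟨x, hx, h⟩ := hd i
    rw [h]
    exact_mod_cast hx.ne'
  have : Invertible g := Matrix.invertibleOfIsUnitDet g hdet
  have hinv : ∀ i j, j < i → g⁻¹ i j = 0 := fun i j hij =>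
    Matrix.blockTriangular_inv_of_blockTriangular hU hij
  refine ⟨hg, fun i j hij => ?_, fun i => ?_, Matrix.conjTranspose_conjTranspose _⟩
  · simp [Matrix.conjTranspose_apply, hinv j i hij]
  · have h1 : (g * g⁻¹) i i = 1 := by rw [Matrix.mul_nonsing_inv _ hdet, Matrix.one_apply_eq]
    rw [Matrix.mul_apply, Finset.sum_eq_single i] at h1
    · obtain ⟨x, hx, h⟩ := hd i
      have h2 : (starRingEnd ℂ) (g i i) = g i i := by rw [h, Complex.conj_ofReal]
      have h3 := congrArg (starRingEnd ℂ) h1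
      rw [map_mul, h2, map_one] at h3
      exact h3
    · intro j _ hj
      rcases lt_or_gt_of_ne hj with h | h
      · rw [hg i j h, zero_mul]
      · rw [hinv j i h, mul_zero]
    · simp

theorem exists_mem_minorChart {n : ℕ} (y : GZIndex n → ℂ) (hy : ∀ c, y c ≠ 0)
    (hr : ∀ c, IsRealIdx c → ∃ x : ℝ, 0 < x ∧ y c = x) :
    ∃ p ∈ minorChart n, ∀ c, solidMinor p.1 c = y c := by
  -- The signed minors prescribe the products of pivots, so their ratios `ψ` prescribe the pivots.
  -- The default value `1` outside the index set keeps every pivot nonzero.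
  let Y : ℕ → ℕ → ℂ := fun k l =>
    if h : k < n ∧ l < k + 1 then revSign l * y ⟨⟨k, h.1⟩, ⟨l, h.2⟩⟩ else 1
  have hY : ∀ k l, Y k l ≠ 0 := fun k l => by
    simp only [Y]
    split_ifs with h
    · exact mul_ne_zero (revSign_ne_zero l) (hy _)
    · exact one_ne_zero
  let ψ : ℕ → ℕ → ℂ := fun k l => if l = 0 then Y k 0 else Y k l / Y k (l - 1)
  have hψ : ∀ k l, ψ k l ≠ 0 := fun k l => by
    simp only [ψ]
    split_ifs with h
    · exact hY k 0
    · exact div_ne_zero (hY _ _) (hY _ _)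
  have hprod : ∀ k l, ∏ j ∈ Finset.range (l + 1), ψ k j = Y k l := fun k l => by
    induction l with
    | zero => simp [ψ]
    | succ l ih =>
      rw [Finset.prod_range_succ, ih]
      simp only [ψ, Nat.succ_ne_zero, if_false, Nat.add_sub_cancel]
      exact mul_div_cancel₀ _ (hY k l)
  have hρ := fun k l (h : l ≤ k) => invNevilleRow_props hψ (k - l) k l (by omega)
  let g : Mat n := Matrix.of fun i j => invNevilleRow ψ (n - 1 - i) 0 (n - 1 - j)
  have hrow : ∀ k < n, ∀ c, invNevilleRow ψ k 0 c = revEntry g k c := by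
    intro k hk c
    unfold revEntry
    split_ifs with h
    · simp only [g, Matrix.of_apply]
      congr 1 <;> omega
    · exact (hρ k 0 (Nat.zero_le _)).1 c (by omega)
  have hg : ∀ i j, j < i → g i j = 0 := fun i j hij => by
    have hi := i.isLt
    have hij : (j : ℕ) < i := hij
    exact (hρ _ 0 (Nat.zero_le _)).1 _ (by omega)
  have hmin : ∀ c, solidMinor g c = y c := by
    rintro ⟨⟨k, hk⟩, ⟨l, hl⟩⟩
    have hl' : l < k + 1 := hl
    rw [(isNeville_invNevilleRow hψ).solidMinor_eq hrow hk hl fun s hs t ht =>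
      (hρ k s (by omega)).1 t (by omega)]
    rw [Finset.prod_congr rfl fun j hj => (hρ k j (by
      have := Finset.mem_range.mp hj
      omega)).2, hprod]
    simp only [Y]
    rw [dif_pos ⟨hk, hl⟩, ← mul_assoc, revSign_mul_self, one_mul]
  have hpos : ∀ c, IsRealIdx c → ∃ x : ℝ, 0 < x ∧ solidMinor g c = x := fun c hc => by
    rw [hmin]
    exact hr c hc
  refine ⟨(g, (g⁻¹)ᴴ), ⟨mem_dualGroup_of_upperTriangular hg fun i => ?_, hpos, fun c => ?_⟩, hmin⟩
  · rw [← revEntry_rev g i i]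
    exact revEntry_self_pos hg hpos (by have := i.isLt; omega)
  · rw [hmin]
    exact hy c

/-! ## Laurent monomials on the chart -/

/-- The Laurent monomial with exponent `m` in values `y` of the coordinates. -/
def monomialVal {n : ℕ} (y : GZIndex n → ℂ) (m : Coord (GZIndex n) IsRealIdx → ℤ) : ℂ :=
  ∏ v, Coord.val y v ^ m v

/-- The group of possible values of the coordinates on the chart. -/
def chartTorus (n : ℕ) : Subgroup (GZIndex n → ℂˣ) where
  carrier := {y | ∀ c, IsRealIdx c → ∃ x : ℝ, 0 < x ∧ (y c : ℂ) = x}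
  mul_mem' := by
    intro a b ha hb c hc
    obtain ⟨x, hx, hxe⟩ := ha c hc
    obtain ⟨z, hz, hze⟩ := hb c hc
    exact ⟨x * z, mul_pos hx hz, by simp [hxe, hze]⟩
  one_mem' := fun c _ => ⟨1, one_pos, by simp⟩
  inv_mem' := by
    intro a ha c hc
    obtain ⟨x, hx, hxe⟩ := ha c hc
    exact ⟨x⁻¹, inv_pos.mpr hx, by simp [hxe]⟩

/-- A Laurent monomial as a character of the torus. -/
def torusCharacter {n : ℕ} (m : Coord (GZIndex n) IsRealIdx → ℤ) : chartTorus n →* ℂ where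
  toFun y := monomialVal (fun c => (y.1 c : ℂ)) m
  map_one' := by
    refine Finset.prod_eq_one fun v _ => ?_
    cases v <;> simp [Coord.val]
  map_mul' a b := by
    unfold monomialVal
    rw [← Finset.prod_mul_distrib]
    refine Finset.prod_congr rfl fun v _ => ?_
    rw [← mul_zpow]
    cases v <;> simp [Coord.val]

theorem monomialVal_update_of_isRealIdx {n : ℕ} {c : GZIndex n} (hc : IsRealIdx c) (z : ℂ)
    (m : Coord (GZIndex n) IsRealIdx → ℤ) :
    monomialVal (Function.update 1 c z) m = z ^ m (Sum.inl c) := by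
  unfold monomialVal
  rw [Fintype.prod_sum_type, Finset.prod_eq_single c, Finset.prod_eq_one]
  · simp [Coord.val]
  · rintro ⟨a, ha⟩ _
    have : a ≠ c := fun h => ha (h ▸ hc)
    simp [Coord.val, Function.update_of_ne this]
  · intro a _ h
    simp [Coord.val, Function.update_of_ne h]
  · simp

theorem monomialVal_update_of_not_isRealIdx {n : ℕ} {c : GZIndex n} (hc : ¬ IsRealIdx c) (z : ℂ)
    (m : Coord (GZIndex n) IsRealIdx → ℤ) :
    monomialVal (Function.update 1 c z) m =
      z ^ m (Sum.inl c) * (starRingEnd ℂ) z ^ m (Sum.inr ⟨c, hc⟩) := by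
  unfold monomialVal
  rw [Fintype.prod_sum_type, Finset.prod_eq_single c, Finset.prod_eq_single ⟨c, hc⟩]
  · simp [Coord.val]
  · rintro ⟨a, ha⟩ _ h
    have : a ≠ c := fun h' => h (Subtype.ext h')
    simp [Coord.val, Function.update_of_ne this]
  · simp
  · intro a _ h
    simp [Coord.val, Function.update_of_ne h]
  · simp

/-- Vary one coordinate at a time. The value `2` determines the exponent of a real coordinate, and
for a complex one the sum of the exponents of `z` and its conjugate; a point of the unit circle
determines their difference. -/
theorem torusCharacter_injective {n : ℕ} : Function.Injective (@torusCharacter n) := by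
  intro m m' h
  have key : ∀ (c : GZIndex n) (z : ℂ), z ≠ 0 → (IsRealIdx c → ∃ x : ℝ, 0 < x ∧ z = x) →
      monomialVal (Function.update 1 c z) m = monomialVal (Function.update 1 c z) m' := by
    intro c z hz hr
    have hmem : Function.update (1 : GZIndex n → ℂˣ) c (Units.mk0 z hz) ∈ chartTorus n := by
      intro d hd
      by_cases hdc : d = c
      · subst hdc
        simpa using hr hd
      · exact ⟨1, one_pos, by simp [Function.update_of_ne hdc]⟩
    have h1 := DFunLike.congr_fun h ⟨_, hmem⟩
    have h2 : (fun d => ((Function.update (1 : GZIndex n → ℂˣ) c (Units.mk0 z hz) d : ℂˣ) : ℂ)) =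
        Function.update (1 : GZIndex n → ℂ) c z := by
      ext d
      by_cases hdc : d = c
      · subst hdc; simp
      · simp [Function.update_of_ne hdc]
    change monomialVal _ m = monomialVal _ m' at h1
    rwa [h2] at h1
  have two : ∀ a b : ℤ, (2 : ℂ) ^ a = 2 ^ b → a = b := fun a b hab => by
    have hab : (2 : ℝ) ^ a = 2 ^ b := by simpa [norm_zpow] using congrArg norm hab
    exact zpow_right_injective₀ (by norm_num : (0 : ℝ) < 2) (by norm_num) hab
  have hreal : ∀ c, IsRealIdx c → m (Sum.inl c) = m' (Sum.inl c) := fun c hc => by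
    have h1 := key c 2 two_ne_zero fun _ => ⟨2, two_pos, by norm_num⟩
    rw [monomialVal_update_of_isRealIdx hc, monomialVal_update_of_isRealIdx hc] at h1
    exact two _ _ h1
  have hcomplex : ∀ c (hc : ¬ IsRealIdx c), m (Sum.inl c) = m' (Sum.inl c) ∧
      m (Sum.inr ⟨c, hc⟩) = m' (Sum.inr ⟨c, hc⟩) := fun c hc => by
    have h1 := key c 2 two_ne_zero fun h => absurd h hc
    simp only [monomialVal_update_of_not_isRealIdx hc, map_ofNat] at h1
    rw [← zpow_add₀ two_ne_zero, ← zpow_add₀ two_ne_zero] at h1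
    have h2 := two _ _ h1
    by_contra hne
    have hd : m (Sum.inl c) - m (Sum.inr ⟨c, hc⟩) - (m' (Sum.inl c) - m' (Sum.inr ⟨c, hc⟩)) ≠ 0 := by
      intro h0
      exact hne ⟨by omega, by omega⟩
    set d := m (Sum.inl c) - m (Sum.inr ⟨c, hc⟩) - (m' (Sum.inl c) - m' (Sum.inr ⟨c, hc⟩)) with hdd
    have hdC : (d : ℂ) ≠ 0 := by exact_mod_cast hd
    -- If the differences of exponents disagree by `d ≠ 0`, the two monomials differ at the angle `π
    -- / d` by the factor `exp (π i) = -1`.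
    have h3 := key c (Complex.exp (Real.pi / d * Complex.I)) (Complex.exp_ne_zero _)
      fun h => absurd h hc
    have hconj : (starRingEnd ℂ) (Complex.exp (Real.pi / d * Complex.I)) =
        Complex.exp (-(Real.pi / d * Complex.I)) := by
      rw [← Complex.exp_conj]
      simp
    simp only [monomialVal_update_of_not_isRealIdx hc, hconj] at h3
    rw [← Complex.exp_int_mul, ← Complex.exp_int_mul, ← Complex.exp_int_mul,
      ← Complex.exp_int_mul, ← Complex.exp_add, ← Complex.exp_add, ← div_eq_one_iff_eq
      (Complex.exp_ne_zero _), ← Complex.exp_sub] at h3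
    have h4 : (m (Sum.inl c) : ℂ) * (Real.pi / d * Complex.I) +
        m (Sum.inr ⟨c, hc⟩) * -(Real.pi / d * Complex.I) -
        (m' (Sum.inl c) * (Real.pi / d * Complex.I) +
        m' (Sum.inr ⟨c, hc⟩) * -(Real.pi / d * Complex.I)) = Real.pi * Complex.I := by
      have : (d : ℂ) = m (Sum.inl c) - m (Sum.inr ⟨c, hc⟩) -
          (m' (Sum.inl c) - m' (Sum.inr ⟨c, hc⟩)) := by
        rw [hdd]; push_cast; ring
      field_simp
      rw [this]
      ring
    rw [h4, Complex.exp_pi_mul_I] at h3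
    norm_num at h3
  ext v
  rcases v with c | ⟨c, hc⟩
  · by_cases hc : IsRealIdx c
    · exact hreal c hc
    · exact (hcomplex c hc).1
  · exact (hcomplex c hc).2

/-- The Laurent monomial with exponent `m` as a function on the chart. -/
def chartMonomial {n : ℕ} (m : Coord (GZIndex n) IsRealIdx → ℤ) : minorChart n → ℂ :=
  fun p => monomialVal (fun c => solidMinor p.1.1 c) m

/-- Every torus point is realised by a point of the chart, so the monomials restrict along such a
choice to distinct characters, and Dedekind's independence of characters applies. -/
theorem linearIndependent_chartMonomial {n : ℕ} :
    LinearIndependent ℂ (@chartMonomial n) := by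
  have h : ∀ y : chartTorus n, ∃ p : minorChart n, ∀ c, solidMinor p.1.1 c = y.1 c := by
    intro y
    obtain ⟨p, hp, he⟩ := exists_mem_minorChart (fun c => (y.1 c : ℂ)) (fun c => (y.1 c).ne_zero)
      y.2
    exact ⟨⟨p, hp⟩, he⟩
  choose s hs using h
  refine LinearIndependent.of_comp (LinearMap.funLeft ℂ ℂ s) ?_
  have h1 : (LinearMap.funLeft ℂ ℂ s) ∘ (@chartMonomial n) = fun m => ⇑(torusCharacter m) := by
    ext m y
    simp only [Function.comp_apply, LinearMap.funLeft_apply, chartMonomial, hs]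
    rfl
  rw [h1]
  exact (linearIndependent_monoidHom (chartTorus n) ℂ).comp _ torusCharacter_injective

/-! ## Exponents and weights -/

/-- The weight of a Laurent monomial when the coordinate with index `c` has weight `ξ c`. -/
def coordWeight {n : ℕ} (ξ : GZIndex n → ℝ) :
    (Coord (GZIndex n) IsRealIdx → ℤ) →+ ℝ where
  toFun m := ∑ w, (m w : ℝ) * ξ w.idx
  map_zero' := by simp
  map_add' a b := by simp [add_mul, Finset.sum_add_distrib]

theorem coordWeight_apply {n : ℕ} (ξ : GZIndex n → ℝ) (m : Coord (GZIndex n) IsRealIdx → ℤ) :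
    coordWeight ξ m = ∑ w, (m w : ℝ) * ξ w.idx := rfl

theorem coordWeight_single {n : ℕ} (ξ : GZIndex n → ℝ) (v : Coord (GZIndex n) IsRealIdx) :
    coordWeight ξ (Pi.single v 1) = ξ v.idx := by
  rw [coordWeight_apply, Finset.sum_eq_single v]
  · simp
  · intro w _ h
    simp [Pi.single_eq_of_ne h]
  · simp

theorem coordWeight_logCanonicalExponent {n : ℕ} (ξ : GZIndex n → ℝ)
    (u v : Coord (GZIndex n) IsRealIdx) :
    coordWeight ξ (logCanonicalExponent u v) = ξ u.idx + ξ v.idx := by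
  rw [logCanonicalExponent, map_add, coordWeight_single, coordWeight_single]

/-- The effect of complex conjugation on exponents. -/
def conjExponent {n : ℕ} (m : Coord (GZIndex n) IsRealIdx → ℤ) :
    Coord (GZIndex n) IsRealIdx → ℤ
  | Sum.inl c => if h : IsRealIdx c then m (Sum.inl c) else m (Sum.inr ⟨c, h⟩)
  | Sum.inr a => m (Sum.inl a.1)

theorem prod_coord {n : ℕ} {M : Type*} [CommMonoid M] (F : Coord (GZIndex n) IsRealIdx → M) :
    ∏ v, F v = ∏ c, F (Sum.inl c) * if h : IsRealIdx c then 1 else F (Sum.inr ⟨c, h⟩) := by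
  rw [Fintype.prod_sum_type, Finset.prod_mul_distrib,
    ← Fintype.prod_subtype_mul_prod_subtype (fun c => @IsRealIdx n c)
      (fun c => if h : IsRealIdx c then 1 else F (Sum.inr ⟨c, h⟩))]
  congr 1
  rw [Finset.prod_eq_one (s := (Finset.univ : Finset {c // @IsRealIdx n c}))
    fun a _ => dif_pos a.2, one_mul]
  exact Finset.prod_congr rfl fun a _ => by rw [dif_neg a.2]

theorem sum_coord {n : ℕ} {M : Type*} [AddCommMonoid M] (F : Coord (GZIndex n) IsRealIdx → M) :
    ∑ v, F v = ∑ c, (F (Sum.inl c) + if h : IsRealIdx c then 0 else F (Sum.inr ⟨c, h⟩)) := by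
  have := prod_coord (M := Multiplicative M) (fun v => Multiplicative.ofAdd (F v))
  apply_fun Multiplicative.toAdd at this
  rw [toAdd_prod, toAdd_prod] at this
  refine this.trans (Finset.sum_congr rfl fun c _ => ?_)
  rw [toAdd_mul]
  split_ifs <;> rfl

theorem coordWeight_conjExponent {n : ℕ} (ξ : GZIndex n → ℝ)
    (m : Coord (GZIndex n) IsRealIdx → ℤ) : coordWeight ξ (conjExponent m) = coordWeight ξ m := by
  rw [coordWeight_apply, coordWeight_apply, sum_coord, sum_coord]
  refine Finset.sum_congr rfl fun c _ => ?_
  by_cases h : IsRealIdx c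
  · simp [conjExponent, h]
  · simp [conjExponent, h, Coord.idx, add_comm]

/-! ## Spans of Laurent monomials on the chart -/

theorem chart_coord_ne_zero {n : ℕ} (p : minorChart n) (v : Coord (GZIndex n) IsRealIdx) :
    Coord.val (fun c => solidMinor p.1.1 c) v ≠ 0 := by
  cases v with
  | inl c => exact p.2.2.2 c
  | inr a => exact (map_ne_zero _).mpr (p.2.2.2 a.1)

theorem chartMonomial_zero {n : ℕ} : chartMonomial (0 : Coord (GZIndex n) IsRealIdx → ℤ) = 1 := by
  ext p
  simp [chartMonomial, monomialVal]

theorem chartMonomial_add {n : ℕ} (m m' : Coord (GZIndex n) IsRealIdx → ℤ) :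
    chartMonomial (m + m') = chartMonomial m * chartMonomial m' := by
  ext p
  simp only [chartMonomial, monomialVal, Pi.mul_apply, ← Finset.prod_mul_distrib]
  exact Finset.prod_congr rfl fun v _ => zpow_add₀ (chart_coord_ne_zero p v) _ _

theorem chartMonomial_neg {n : ℕ} (m : Coord (GZIndex n) IsRealIdx → ℤ) :
    chartMonomial (-m) = (chartMonomial m)⁻¹ := by
  ext p
  simp [chartMonomial, monomialVal]

theorem chartMonomial_sub {n : ℕ} (m m' : Coord (GZIndex n) IsRealIdx → ℤ) :
    chartMonomial (m - m') = chartMonomial m / chartMonomial m' := by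
  rw [sub_eq_add_neg, chartMonomial_add, chartMonomial_neg, div_eq_mul_inv]

theorem chartMonomial_single {n : ℕ} (v : Coord (GZIndex n) IsRealIdx) (p : minorChart n) :
    chartMonomial (Pi.single v 1) p = Coord.val (fun c => solidMinor p.1.1 c) v := by
  rw [chartMonomial, monomialVal, Finset.prod_eq_single v]
  · simp
  · intro w _ h
    simp [Pi.single_eq_of_ne h]
  · simp

theorem conj_solidMinor_of_isRealIdx {n : ℕ} (p : minorChart n) {c : GZIndex n}
    (hc : IsRealIdx c) : (starRingEnd ℂ) (solidMinor p.1.1 c) = solidMinor p.1.1 c := by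
  obtain ⟨x, -, hx⟩ := p.2.2.1 c hc
  rw [hx, Complex.conj_ofReal]

theorem star_chartMonomial {n : ℕ} (m : Coord (GZIndex n) IsRealIdx → ℤ) :
    star (chartMonomial m) = chartMonomial (conjExponent m) := by
  ext p
  rw [Pi.star_apply]
  simp only [chartMonomial, monomialVal]
  rw [prod_coord, prod_coord, ← starRingEnd_apply, map_prod]
  refine Finset.prod_congr rfl fun c _ => ?_
  by_cases h : IsRealIdx c
  · simp [h, conjExponent, Coord.val, conj_solidMinor_of_isRealIdx p h]
  · simp [h, conjExponent, Coord.val, mul_comm]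

/-- The functions on the chart that are Laurent polynomials with exponents in `S`. -/
def laurentSpan {n : ℕ} (S : Set (Coord (GZIndex n) IsRealIdx → ℤ)) :
    Submodule ℂ (minorChart n → ℂ) :=
  Submodule.span ℂ (chartMonomial '' S)

theorem chartMonomial_mem_laurentSpan {n : ℕ} {S : Set (Coord (GZIndex n) IsRealIdx → ℤ)}
    {m : Coord (GZIndex n) IsRealIdx → ℤ} (h : m ∈ S) : chartMonomial m ∈ laurentSpan S :=
  Submodule.subset_span ⟨m, h, rfl⟩

theorem laurentSpan_mono {n : ℕ} {S T : Set (Coord (GZIndex n) IsRealIdx → ℤ)} (h : S ⊆ T) :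
    laurentSpan S ≤ laurentSpan T :=
  Submodule.span_mono (Set.image_mono h)

theorem mul_mem_laurentSpan {n : ℕ} {S T R : Set (Coord (GZIndex n) IsRealIdx → ℤ)}
    (h : ∀ a ∈ S, ∀ b ∈ T, a + b ∈ R) {φ χ : minorChart n → ℂ} (hφ : φ ∈ laurentSpan S)
    (hχ : χ ∈ laurentSpan T) : φ * χ ∈ laurentSpan R := by
  have h1 := Submodule.mul_mem_mul hφ hχ
  rw [laurentSpan, laurentSpan, Submodule.span_mul_span] at h1
  refine Submodule.span_mono ?_ h1
  rintro _ ⟨_, ⟨a, ha, rfl⟩, _, ⟨b, hb, rfl⟩, rfl⟩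
  exact ⟨a + b, h a ha b hb, chartMonomial_add a b⟩

theorem star_mem_laurentSpan {n : ℕ} {S : Set (Coord (GZIndex n) IsRealIdx → ℤ)}
    (h : ∀ a ∈ S, conjExponent a ∈ S) {φ : minorChart n → ℂ} (hφ : φ ∈ laurentSpan S) :
    star φ ∈ laurentSpan S := by
  induction hφ using Submodule.span_induction with
  | mem x hx =>
    obtain ⟨a, ha, rfl⟩ := hx
    rw [star_chartMonomial]
    exact chartMonomial_mem_laurentSpan (h a ha)
  | zero => simp
  | add x y _ _ hx hy => rw [star_add]; exact Submodule.add_mem _ hx hy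
  | smul a x _ hx => rw [star_smul]; exact Submodule.smul_mem _ _ hx

/-- Laurent polynomials all of whose monomials have negative weight. -/
def smallSpan {n : ℕ} (ξ : GZIndex n → ℝ) : Submodule ℂ (minorChart n → ℂ) :=
  laurentSpan {m | coordWeight ξ m < 0}

/-- Laurent polynomials all of whose monomials have weight at most zero. -/
def boundedSpan {n : ℕ} (ξ : GZIndex n → ℝ) : Submodule ℂ (minorChart n → ℂ) :=
  laurentSpan {m | coordWeight ξ m ≤ 0}

theorem smallSpan_le_boundedSpan {n : ℕ} (ξ : GZIndex n → ℝ) : smallSpan ξ ≤ boundedSpan ξ :=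
  laurentSpan_mono fun m (h : coordWeight ξ m < 0) => h.le

theorem mul_mem_smallSpan {n : ℕ} {ξ : GZIndex n → ℝ} {φ χ : minorChart n → ℂ}
    (hφ : φ ∈ smallSpan ξ) (hχ : χ ∈ boundedSpan ξ) : φ * χ ∈ smallSpan ξ :=
  mul_mem_laurentSpan (fun a ha b hb => by
    rw [Set.mem_ofPred_eq, map_add]; exact add_neg_of_neg_of_nonpos ha hb) hφ hχ

theorem mul_mem_smallSpan' {n : ℕ} {ξ : GZIndex n → ℝ} {φ χ : minorChart n → ℂ}
    (hφ : φ ∈ boundedSpan ξ) (hχ : χ ∈ smallSpan ξ) : φ * χ ∈ smallSpan ξ := by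
  rw [mul_comm]
  exact mul_mem_smallSpan hχ hφ

theorem mul_mem_boundedSpan {n : ℕ} {ξ : GZIndex n → ℝ} {φ χ : minorChart n → ℂ}
    (hφ : φ ∈ boundedSpan ξ) (hχ : χ ∈ boundedSpan ξ) : φ * χ ∈ boundedSpan ξ :=
  mul_mem_laurentSpan (fun a ha b hb => by
    rw [Set.mem_ofPred_eq, map_add]; exact add_nonpos ha hb) hφ hχ

theorem star_mem_smallSpan {n : ℕ} {ξ : GZIndex n → ℝ} {φ : minorChart n → ℂ}
    (hφ : φ ∈ smallSpan ξ) : star φ ∈ smallSpan ξ :=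
  star_mem_laurentSpan (fun a ha => by
    rw [Set.mem_ofPred_eq, coordWeight_conjExponent]; exact ha) hφ

theorem star_mem_boundedSpan {n : ℕ} {ξ : GZIndex n → ℝ} {φ : minorChart n → ℂ}
    (hφ : φ ∈ boundedSpan ξ) : star φ ∈ boundedSpan ξ :=
  star_mem_laurentSpan (fun a ha => by
    rw [Set.mem_ofPred_eq, coordWeight_conjExponent]; exact ha) hφ

theorem one_mem_boundedSpan {n : ℕ} (ξ : GZIndex n → ℝ) :
    (1 : minorChart n → ℂ) ∈ boundedSpan ξ := by
  rw [← chartMonomial_zero]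
  exact chartMonomial_mem_laurentSpan (by simp)

theorem const_mem_boundedSpan {n : ℕ} (ξ : GZIndex n → ℝ) (a : ℂ) :
    (fun _ => a : minorChart n → ℂ) ∈ boundedSpan ξ := by
  have : (fun _ => a : minorChart n → ℂ) = a • 1 := by ext; simp
  rw [this]
  exact Submodule.smul_mem _ _ (one_mem_boundedSpan ξ)

/-! ## Pivots -/

/-- The values of a function on `GZIndex n`, extended by zero. -/
def extendIdx {n : ℕ} {M : Type*} [Zero M] (ξ : GZIndex n → M) (k l : ℕ) : M :=
  if h : k < n ∧ l < k + 1 then ξ ⟨⟨k, h.1⟩, ⟨l, h.2⟩⟩ else 0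

theorem extendIdx_of_lt {n : ℕ} {M : Type*} [Zero M] (ξ : GZIndex n → M) {k l : ℕ} (hk : k < n)
    (hl : l < k + 1) : extendIdx ξ k l = ξ ⟨⟨k, hk⟩, ⟨l, hl⟩⟩ := dif_pos ⟨hk, hl⟩

/-- The successive differences `ξ^(k)_l - ξ^(k)_(l-1)`. -/
def idxDiff {n : ℕ} {M : Type*} [AddGroup M] (ξ : GZIndex n → M) (k : ℕ) : ℕ → M
  | 0 => extendIdx ξ k 0
  | l + 1 => extendIdx ξ k (l + 1) - extendIdx ξ k l

/-- The exponent of a pivot of Neville elimination. -/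
def pivotExponent (n k l : ℕ) : Coord (GZIndex n) IsRealIdx → ℤ :=
  idxDiff (fun c : GZIndex n => Pi.single (Sum.inl c) 1) k l

theorem coordWeight_pivotExponent {n : ℕ} (ξ : GZIndex n → ℝ) (k l : ℕ) :
    coordWeight ξ (pivotExponent n k l) = idxDiff ξ k l := by
  have h : ∀ k l, coordWeight ξ (extendIdx (fun c : GZIndex n =>
      (Pi.single (Sum.inl c) 1 : Coord (GZIndex n) IsRealIdx → ℤ)) k l) = extendIdx ξ k l := by
    intro k l
    unfold extendIdx
    split_ifs
    · exact coordWeight_single _ _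
    · exact map_zero _
  cases l with
  | zero => exact h k 0
  | succ l =>
    rw [pivotExponent, idxDiff, map_sub, h, h]
    rfl

/-- The sign relating pivots of Neville elimination to ratios of minors. -/
def pivotSign : ℕ → ℂ
  | 0 => revSign 0
  | l + 1 => revSign (l + 1) * revSign l

theorem pivotSign_mul_self (l : ℕ) : pivotSign l * pivotSign l = 1 := by
  cases l with
  | zero => exact revSign_mul_self 0
  | succ l =>
    simp only [pivotSign]
    rw [mul_mul_mul_comm, revSign_mul_self, revSign_mul_self, one_mul]

theorem pivotSign_ne_zero (l : ℕ) : pivotSign l ≠ 0 :=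
  left_ne_zero_of_mul (b := pivotSign l) (by simp [pivotSign_mul_self])

theorem conj_pivotSign (l : ℕ) : (starRingEnd ℂ) (pivotSign l) = pivotSign l := by
  cases l <;> simp [pivotSign, conj_revSign]

theorem chartMonomial_extendIdx {n k l : ℕ} (hk : k < n) (hl : l < k + 1) (p : minorChart n) :
    chartMonomial (extendIdx (fun c : GZIndex n =>
      (Pi.single (Sum.inl c) 1 : Coord (GZIndex n) IsRealIdx → ℤ)) k l) p =
      solidMinor p.1.1 ⟨⟨k, hk⟩, ⟨l, hl⟩⟩ := by
  rw [extendIdx_of_lt _ hk hl, chartMonomial_single]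
  rfl

/-- The minors `(k, l)` and `(k, l - 1)` are products of pivots of the same `k` that differ by one
factor, so the pivot is their ratio up to sign. The sign depends on `l` alone and hence cancels in
the multipliers. -/
theorem nevilleRow_pivot {n k l : ℕ} (hk : k < n) (hl : l ≤ k) (p : minorChart n) :
    nevilleRow (revEntry p.1.1) k l l = pivotSign l * chartMonomial (pivotExponent n k l) p := by
  have h1 := solidMinor_eq_prod_nevilleRow p.2.2.2 hk (show l < k + 1 by omega)
  cases l with
  | zero =>
    rw [pivotExponent, idxDiff, chartMonomial_extendIdx hk (by omega), h1, ← mul_assoc]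
    simp [pivotSign, revSign_mul_self]
  | succ l =>
    have h2 := solidMinor_eq_prod_nevilleRow p.2.2.2 hk (show l < k + 1 by omega)
    rw [pivotExponent, idxDiff, chartMonomial_sub, Pi.div_apply,
      chartMonomial_extendIdx hk (by omega), chartMonomial_extendIdx hk (by omega)]
    rw [Finset.prod_range_succ] at h1
    have h3 := p.2.2.2 ⟨⟨k, hk⟩, ⟨l, Nat.lt_succ_of_lt hl⟩⟩
    rw [mul_div_assoc', eq_div_iff h3, h1, h2, pivotSign]
    linear_combination (-(revSign l * nevilleRow (revEntry p.1.1) k (l + 1) (l + 1) *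
      ∏ j ∈ Finset.range (l + 1), nevilleRow (revEntry p.1.1) k j j)) * revSign_mul_self (l + 1)

theorem nevilleMul_eq {n k l : ℕ} (hk : k + 1 < n) (hl : l ≤ k) (p : minorChart n) :
    nevilleMul (revEntry p.1.1) k l =
      chartMonomial (pivotExponent n k l - pivotExponent n (k + 1) l) p := by
  rw [nevilleMul, nevilleRow_pivot (by omega) hl, nevilleRow_pivot hk (by omega),
    chartMonomial_sub, Pi.div_apply, mul_div_mul_left _ _ (pivotSign_ne_zero l)]

theorem pivot_ratio_eq {n k l : ℕ} (hk : k + 1 < n) (hl : l ≤ k) (p : minorChart n) :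
    nevilleRow (revEntry p.1.1) (k + 1) (l + 1) (l + 1) / nevilleRow (revEntry p.1.1) k l l =
      pivotSign (l + 1) * pivotSign l *
        chartMonomial (pivotExponent n (k + 1) (l + 1) - pivotExponent n k l) p := by
  rw [nevilleRow_pivot (by omega) hl, nevilleRow_pivot hk (by omega),
    chartMonomial_sub, Pi.div_apply, mul_div_mul_comm]
  congr 1
  rw [div_eq_iff (pivotSign_ne_zero l), mul_assoc, pivotSign_mul_self, mul_one]

/-! ## Weights of the Neville coefficients -/

/-- The exponent of the multiplier `nevilleMul`. -/
def mulExponent (n k l : ℕ) : Coord (GZIndex n) IsRealIdx → ℤ :=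
  pivotExponent n k l - pivotExponent n (k + 1) l

/-- The exponent of the ratio of the pivots `(k + 1, l + 1)` and `(k, l)`. -/
def ratioExponent (n k l : ℕ) : Coord (GZIndex n) IsRealIdx → ℤ :=
  pivotExponent n (k + 1) (l + 1) - pivotExponent n k l

theorem coordWeight_mulExponent {n : ℕ} (ξ : GZIndex n → ℝ) (k l : ℕ) :
    coordWeight ξ (mulExponent n k l) = idxDiff ξ k l - idxDiff ξ (k + 1) l := by
  rw [mulExponent, map_sub, coordWeight_pivotExponent, coordWeight_pivotExponent]

theorem coordWeight_ratioExponent {n : ℕ} (ξ : GZIndex n → ℝ) (k l : ℕ) :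
    coordWeight ξ (ratioExponent n k l) = idxDiff ξ (k + 1) (l + 1) - idxDiff ξ k l := by
  rw [ratioExponent, map_sub, coordWeight_pivotExponent, coordWeight_pivotExponent]

theorem nevilleMul_eq_chartMonomial {n k l : ℕ} (hk : k + 1 < n) (hl : l ≤ k) :
    (fun p : minorChart n => nevilleMul (revEntry p.1.1) k l) =
      chartMonomial (mulExponent n k l) :=
  funext fun p => nevilleMul_eq hk hl p

/-- For `e ≥ 1` the recursion leaves no constant term: each coefficient is a polynomial in the
multipliers `(k', l')` with `k' < k` and `l' < l`. The exact range matters on a facet, where one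
multiplier has weight zero. -/
theorem nevilleCoeff_mem_smallSpan {n : ℕ} {ξ : GZIndex n → ℝ} {k l e : ℕ} (hk : k < n)
    (hl : l ≤ k) (he : 1 ≤ e)
    (h : ∀ k' < k, ∀ l' < l, l' ≤ k' → idxDiff ξ k' l' < idxDiff ξ (k' + 1) l') :
    (fun p : minorChart n => nevilleCoeff (nevilleMul (revEntry p.1.1)) k l e) ∈ smallSpan ξ := by
  induction l generalizing k e with
  | zero =>
    have : (fun p : minorChart n => nevilleCoeff (nevilleMul (revEntry p.1.1)) k 0 e) = 0 := by
      ext p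
      exact nevilleCoeff_of_lt _ (by omega)
    rw [this]
    exact Submodule.zero_mem _
  | succ l ih =>
    obtain ⟨k, rfl⟩ := Nat.exists_eq_succ_of_ne_zero (show k ≠ 0 by omega)
    obtain ⟨e, rfl⟩ := Nat.exists_eq_succ_of_ne_zero (show e ≠ 0 by omega)
    refine Submodule.sub_mem _ (x := fun p : minorChart n =>
      nevilleCoeff (nevilleMul (revEntry p.1.1)) k l (e + 1)) (y := fun p : minorChart n =>
      nevilleMul (revEntry p.1.1) k l * nevilleCoeff (nevilleMul (revEntry p.1.1)) (k + 1) l e)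
      (ih (by omega) (by omega) (by omega) fun k' hk' l' hl' => h k' (by omega) l' (by omega)) ?_
    refine mul_mem_smallSpan (φ := fun p : minorChart n => nevilleMul (revEntry p.1.1) k l)
      (χ := fun p : minorChart n => nevilleCoeff (nevilleMul (revEntry p.1.1)) (k + 1) l e) ?_ ?_
    · rw [nevilleMul_eq_chartMonomial hk (by omega)]
      refine chartMonomial_mem_laurentSpan ?_
      rw [Set.mem_ofPred_eq, coordWeight_mulExponent]
      exact sub_neg_of_lt (h k (by omega) l (by omega) (by omega))
    · cases e with
      | zero =>
        simp only [nevilleCoeff_zero _ (show l ≤ k + 1 by omega)]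
        exact const_mem_boundedSpan ξ 1
      | succ e =>
        exact smallSpan_le_boundedSpan ξ (ih hk (by omega) (by omega)
          fun k' hk' l' hl' => h k' (by omega) l' (by omega))

/-- The rows produced by Neville elimination, scaled to have pivot `1`. -/
def unitRow {n : ℕ} (k l a : ℕ) : minorChart n → ℂ := fun p =>
  nevilleRow (revEntry p.1.1) k l a / nevilleRow (revEntry p.1.1) k l l

/-- The ratio of the pivots `(k + 1, l + 1)` and `(k, l)`. -/
def pivotRatio {n : ℕ} (k l : ℕ) : minorChart n → ℂ := fun p =>
  nevilleRow (revEntry p.1.1) (k + 1) (l + 1) (l + 1) / nevilleRow (revEntry p.1.1) k l l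

theorem pivotRatio_eq_smul {n k l : ℕ} (hk : k + 1 < n) (hl : l ≤ k) :
    (pivotRatio k l : minorChart n → ℂ) =
      (pivotSign (l + 1) * pivotSign l) • chartMonomial (ratioExponent n k l) :=
  funext fun p => pivot_ratio_eq hk hl p

theorem unitRow_self {n k l : ℕ} (hk : k < n) (hl : l ≤ k) :
    (unitRow k l l : minorChart n → ℂ) = 1 :=
  funext fun p => div_self (nevilleRow_revEntry p.2.2.2 hk hl).2

theorem unitRow_of_lt {n k l a : ℕ} (hk : k < n) (hl : l ≤ k) (ha : a < l) :
    (unitRow k l a : minorChart n → ℂ) = 0 :=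
  funext fun p => by
    simp [unitRow, (nevilleRow_revEntry p.2.2.2 hk hl).1 a ha]

theorem revEntry_eq_zero_of_mem {n : ℕ} (p : minorChart n) {k c : ℕ} (hk : k < n) (hc : k < c) :
    revEntry p.1.1 k c = 0 := by
  unfold revEntry
  split_ifs with h
  · refine p.2.1.1 _ _ ?_
    simp only [Fin.lt_def]
    omega
  · rfl

theorem unitRow_of_gt {n k l a : ℕ} (hk : k < n) (ha : k < a) :
    (unitRow k l a : minorChart n → ℂ) = 0 :=
  funext fun p => by
    simp [unitRow, nevilleRow_eq_zero_of_gt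
      (fun k c hk hc => revEntry_eq_zero_of_mem p hk hc) hk ha]

/-- This is the Neville step divided by the pivot `(k, l)`: after normalisation the multiplier is
absorbed and only the pivot ratio remains. -/
theorem unitRow_succ {n k l a : ℕ} (hk : k + 1 < n) (hl : l ≤ k) :
    (unitRow (k + 1) l a : minorChart n → ℂ) =
      unitRow k l a - pivotRatio k l * unitRow (k + 1) (l + 1) a := by
  ext p
  have h1 := (nevilleRow_revEntry p.2.2.2 (show k < n by omega) hl).2
  have h2 := (nevilleRow_revEntry p.2.2.2 hk (show l ≤ k + 1 by omega)).2
  have h3 := (nevilleRow_revEntry p.2.2.2 hk (show l + 1 ≤ k + 1 by omega)).2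
  simp only [unitRow, pivotRatio, Pi.sub_apply, Pi.mul_apply]
  rw [mul_comm, div_mul_div_cancel₀ h3]
  rw [isNeville_nevilleRow (revEntry p.1.1) k l a hl, nevilleMul]
  field_simp
  ring

theorem pivotRatio_mem_boundedSpan {n : ℕ} {ξ : GZIndex n → ℝ} {k l : ℕ} (hk : k + 1 < n)
    (hl : l ≤ k) (h : idxDiff ξ (k + 1) (l + 1) ≤ idxDiff ξ k l) :
    pivotRatio k l ∈ boundedSpan ξ := by
  rw [pivotRatio_eq_smul hk hl]
  refine Submodule.smul_mem _ _ (chartMonomial_mem_laurentSpan ?_)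
  rw [Set.mem_ofPred_eq, coordWeight_ratioExponent]
  exact sub_nonpos_of_le h

theorem pivotRatio_mem_smallSpan {n : ℕ} {ξ : GZIndex n → ℝ} {k l : ℕ} (hk : k + 1 < n)
    (hl : l ≤ k) (h : idxDiff ξ (k + 1) (l + 1) < idxDiff ξ k l) :
    pivotRatio k l ∈ smallSpan ξ := by
  rw [pivotRatio_eq_smul hk hl]
  refine Submodule.smul_mem _ _ (chartMonomial_mem_laurentSpan ?_)
  rw [Set.mem_ofPred_eq, coordWeight_ratioExponent]
  exact sub_neg_of_lt h

theorem unitRow_mem_boundedSpan {n : ℕ} {ξ : GZIndex n → ℝ} {k l a : ℕ} (hk : k < n)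
    (hl : l ≤ k) (h : ∀ k' < k, ∀ l', l ≤ l' → l' ≤ k' →
      idxDiff ξ (k' + 1) (l' + 1) ≤ idxDiff ξ k' l') :
    unitRow k l a ∈ boundedSpan ξ := by
  obtain ⟨d, hd⟩ := Nat.exists_eq_add_of_le hl
  induction d generalizing k l with
  | zero =>
    obtain rfl : k = l := hd
    rcases lt_trichotomy a k with h1 | rfl | h1
    · rw [unitRow_of_lt hk hl h1]; exact Submodule.zero_mem _
    · rw [unitRow_self hk hl]; exact one_mem_boundedSpan ξ
    · rw [unitRow_of_gt hk h1]; exact Submodule.zero_mem _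
  | succ d ih =>
    obtain ⟨k, rfl⟩ := Nat.exists_eq_succ_of_ne_zero (show k ≠ 0 by omega)
    rw [Nat.succ_eq_add_one, unitRow_succ hk (by omega)]
    refine Submodule.sub_mem _ (ih (by omega) (by omega) (fun k' hk' => h k' (by omega))
      (by omega)) (mul_mem_boundedSpan
      (pivotRatio_mem_boundedSpan hk (by omega) (h k (by omega) l le_rfl (by omega)))
      (ih hk (by omega) (fun k' hk' l' hl' => h k' (by omega) l' (by omega)) (by omega)))

/-- Descending in `k` with `l` fixed ends at `unitRow l l`, which vanishes beyond column `l`. Every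
term collected on the way carries a factor `pivotRatio k' l`, so strictness is needed only for that
`l`. -/
theorem unitRow_mem_smallSpan {n : ℕ} {ξ : GZIndex n → ℝ} {k l a : ℕ} (hk : k < n)
    (hl : l ≤ k) (ha : l < a)
    (h : ∀ k' < k, ∀ l', l ≤ l' → l' ≤ k' → idxDiff ξ (k' + 1) (l' + 1) ≤ idxDiff ξ k' l')
    (h' : ∀ k' < k, l ≤ k' → idxDiff ξ (k' + 1) (l + 1) < idxDiff ξ k' l) :
    unitRow k l a ∈ smallSpan ξ := by
  induction k with
  | zero =>
    rw [unitRow_of_gt hk (by omega)]; exact Submodule.zero_mem _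
  | succ k ih =>
    rcases hl.lt_or_eq with h1 | rfl
    · rw [unitRow_succ hk (by omega)]
      exact Submodule.sub_mem _ (ih (by omega) (by omega) (fun k' hk' => h k' (by omega))
        (fun k' hk' => h' k' (by omega))) (mul_mem_smallSpan
        (pivotRatio_mem_smallSpan hk (by omega) (h' k (by omega) (by omega)))
        (unitRow_mem_boundedSpan hk (by omega) (fun k' hk' l' hl' => h k' (by omega) l' (by omega))))
    · rw [unitRow_of_gt hk ha]; exact Submodule.zero_mem _

/-! ## Logarithmic gradients of solid minors -/

/-- The logarithmic gradient of the minor `solidMinor g c` in the entries of `g`, transposed. -/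
def logGrad {n : ℕ} (g : Mat n) (c : GZIndex n) : Mat n :=
  (1 : Mat n).submatrix id (solidCol c) * (g.submatrix (solidRow c) (solidCol c))⁻¹ *
    (1 : Mat n).submatrix (solidRow c) id

/-- The logarithmic derivatives of a solid minor under row operations. -/
def rowMat {n : ℕ} (g : Mat n) (c : GZIndex n) : Mat n := g * logGrad g c

/-- The logarithmic derivatives of a solid minor under column operations. -/
def colMat {n : ℕ} (g : Mat n) (c : GZIndex n) : Mat n := logGrad g c * g

theorem exists_solidRow_eq {n : ℕ} (c : GZIndex n) (i : Fin n) (h1 : n - (c.1.val + 1) ≤ i)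
    (h2 : (i : ℕ) ≤ n - (c.1.val + 1) + c.2.val) : ∃ a, solidRow c a = i :=
  ⟨⟨i - (n - (c.1.val + 1)), by omega⟩, by ext; simp only [solidRow]; omega⟩

theorem exists_solidCol_eq {n : ℕ} (c : GZIndex n) (i : Fin n) (h1 : n - (c.2.val + 1) ≤ i) :
    ∃ a, solidCol c a = i := by
  have := i.isLt
  have := c.1.isLt
  have := c.2.isLt
  exact ⟨⟨i - (n - (c.2.val + 1)), by omega⟩, by ext; simp only [solidCol]; omega⟩

theorem submatrix_rows_mul_logGrad {n : ℕ} {g : Mat n} {c : GZIndex n}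
    (h : solidMinor g c ≠ 0) :
    g.submatrix (solidRow c) id * logGrad g c = (1 : Mat n).submatrix (solidRow c) id := by
  have h1 : g.submatrix (solidRow c) id * (1 : Mat n).submatrix id (solidCol c) =
      g.submatrix (solidRow c) (solidCol c) := by
    ext a b
    simp [Matrix.mul_apply, Matrix.one_apply]
  rw [logGrad, ← Matrix.mul_assoc, ← Matrix.mul_assoc, h1,
    Matrix.mul_nonsing_inv _ (isUnit_iff_ne_zero.mpr h), Matrix.one_mul]

theorem logGrad_mul_submatrix_cols {n : ℕ} {g : Mat n} {c : GZIndex n}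
    (h : solidMinor g c ≠ 0) :
    logGrad g c * g.submatrix id (solidCol c) = (1 : Mat n).submatrix id (solidCol c) := by
  have h1 : (1 : Mat n).submatrix (solidRow c) id * g.submatrix id (solidCol c) =
      g.submatrix (solidRow c) (solidCol c) := by
    ext a b
    simp [Matrix.mul_apply, Matrix.one_apply]
  rw [logGrad, Matrix.mul_assoc, h1, Matrix.mul_assoc,
    Matrix.nonsing_inv_mul _ (isUnit_iff_ne_zero.mpr h), Matrix.mul_one]

theorem logGrad_apply_eq_zero_left {n : ℕ} (g : Mat n) (c : GZIndex n) {i : Fin n}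
    (h : ∀ a, solidCol c a ≠ i) (j : Fin n) : logGrad g c i j = 0 := by
  rw [logGrad, Matrix.mul_assoc, Matrix.mul_apply]
  refine Finset.sum_eq_zero fun a _ => ?_
  rw [Matrix.submatrix_apply, id, Matrix.one_apply_ne (h a).symm, zero_mul]

theorem logGrad_apply_eq_zero_right {n : ℕ} (g : Mat n) (c : GZIndex n) {j : Fin n}
    (h : ∀ a, solidRow c a ≠ j) (i : Fin n) : logGrad g c i j = 0 := by
  rw [logGrad, Matrix.mul_apply]
  refine Finset.sum_eq_zero fun a _ => ?_
  rw [Matrix.submatrix_apply, id, Matrix.one_apply_ne (h a), mul_zero]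

theorem rowMat_apply_solidRow {n : ℕ} {g : Mat n} {c : GZIndex n} (h : solidMinor g c ≠ 0)
    (a : Fin (c.2.val + 1)) (j : Fin n) :
    rowMat g c (solidRow c a) j = (1 : Mat n) (solidRow c a) j :=
  congrFun (congrFun (submatrix_rows_mul_logGrad h) a) j

theorem colMat_apply_solidCol {n : ℕ} {g : Mat n} {c : GZIndex n} (h : solidMinor g c ≠ 0)
    (i : Fin n) (b : Fin (c.2.val + 1)) :
    colMat g c i (solidCol c b) = (1 : Mat n) i (solidCol c b) :=
  congrFun (congrFun (logGrad_mul_submatrix_cols h) i) b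

theorem rowMat_apply_eq_zero {n : ℕ} (g : Mat n) (c : GZIndex n) {j : Fin n}
    (h : ∀ a, solidRow c a ≠ j) (i : Fin n) : rowMat g c i j = 0 := by
  rw [rowMat, Matrix.mul_apply]
  exact Finset.sum_eq_zero fun t _ => by rw [logGrad_apply_eq_zero_right g c h, mul_zero]

theorem colMat_apply_eq_zero {n : ℕ} (g : Mat n) (c : GZIndex n) {i : Fin n}
    (h : ∀ a, solidCol c a ≠ i) (j : Fin n) : colMat g c i j = 0 := by
  rw [colMat, Matrix.mul_apply]
  exact Finset.sum_eq_zero fun t _ => by rw [logGrad_apply_eq_zero_left g c h, zero_mul]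

theorem trace_rowMat_mul_rowMat {n : ℕ} (g : Mat n) (c d : GZIndex n) :
    (rowMat g c * rowMat g d).trace = (colMat g c * colMat g d).trace := by
  rw [rowMat, rowMat, colMat, colMat, Matrix.mul_assoc, Matrix.trace_mul_comm]
  simp only [Matrix.mul_assoc]

/-! ## Entries counted from the last row and column -/

theorem revEntry_mul {n : ℕ} (A B : Mat n) (k c : ℕ) :
    revEntry (A * B) k c = ∑ t ∈ Finset.range n, revEntry A k t * revEntry B t c := by
  rw [← Finset.sum_range_reflect]
  by_cases h : k < n ∧ c < n
  · rw [← Fin.sum_univ_eq_sum_range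
      (fun t => revEntry A k (n - 1 - t) * revEntry B (n - 1 - t) c) n]
    rw [revEntry, dif_pos h, Matrix.mul_apply]
    refine Finset.sum_congr rfl fun t _ => ?_
    have ht := t.isLt
    rw [revEntry, dif_pos ⟨h.1, by omega⟩, revEntry, dif_pos ⟨by omega, h.2⟩]
    congr 2 <;> ext <;> simp only <;> omega
  · rw [revEntry, dif_neg h, eq_comm]
    refine Finset.sum_eq_zero fun t _ => ?_
    rcases not_and_or.mp h with h | h
    · rw [revEntry, dif_neg (fun h' => h h'.1), zero_mul]
    · rw [revEntry, revEntry, dif_neg (fun h' : _ ∧ c < n => h h'.2), mul_zero]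

/-! ### Recursions for the entries of `rowMat` and `colMat`. -/

section

variable {n : ℕ} {g : Mat n} {k l : ℕ} (hk : k < n) (hl : l < k + 1)

theorem revEntry_logGrad_eq_zero {t : ℕ} (ht : l < t) (a : ℕ) :
    revEntry (logGrad g ⟨⟨k, hk⟩, ⟨l, hl⟩⟩) t a = 0 := by
  unfold revEntry
  split_ifs with h
  · refine logGrad_apply_eq_zero_left g _ (fun b hb => ?_) _
    have hb := congrArg Fin.val hb
    simp only [solidCol] at hb
    omega
  · rfl

theorem revEntry_rowMat_of_mem (hg : solidMinor g ⟨⟨k, hk⟩, ⟨l, hl⟩⟩ ≠ 0) {b : ℕ}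
    (h1 : k - l ≤ b) (h2 : b ≤ k) (a : ℕ) :
    revEntry (rowMat g ⟨⟨k, hk⟩, ⟨l, hl⟩⟩) b a = if b = a then 1 else 0 := by
  by_cases ha : a < n
  · rw [revEntry, dif_pos ⟨by omega, ha⟩]
    obtain ⟨s, hs⟩ := exists_solidRow_eq ⟨⟨k, hk⟩, ⟨l, hl⟩⟩ ⟨n - 1 - b, by omega⟩
      (by simp only; omega) (by simp only; omega)
    rw [← hs, rowMat_apply_solidRow hg, hs, Matrix.one_apply]
    congr 1
    rw [Fin.mk.injEq, eq_iff_iff]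
    omega
  · rw [revEntry, dif_neg (by omega), if_neg (by omega)]

theorem revEntry_colMat_of_gt {j : ℕ} (hj : l < j) (a : ℕ) :
    revEntry (colMat g ⟨⟨k, hk⟩, ⟨l, hl⟩⟩) j a = 0 := by
  rw [colMat, revEntry_mul]
  exact Finset.sum_eq_zero fun t _ => by rw [revEntry_logGrad_eq_zero hk hl hj, zero_mul]

/-- The Neville row `(b + l + 1, l + 1)` is a combination of the rows `b, …, b + l + 1` of `g` that
vanishes in the columns `0, …, l`, and these are the only rows of `logGrad` that can be nonzero. -/
theorem sum_nevilleCoeff_mul_rowMat (hg : ∀ c, solidMinor g c ≠ 0) {b : ℕ} (hb : b + l + 1 ≤ k)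
    (a : ℕ) :
    ∑ e ∈ Finset.range (l + 2), nevilleCoeff (nevilleMul (revEntry g)) (b + l + 1) (l + 1) e *
      revEntry (rowMat g ⟨⟨k, hk⟩, ⟨l, hl⟩⟩) (b + e) a = 0 := by
  simp only [rowMat, revEntry_mul, Finset.mul_sum]
  rw [Finset.sum_comm]
  refine Finset.sum_eq_zero fun t _ => ?_
  rcases lt_or_ge l t with ht | ht
  · exact Finset.sum_eq_zero fun e _ => by
      rw [revEntry_logGrad_eq_zero hk hl ht, mul_zero, mul_zero]
  · have h1 := (nevilleRow_revEntry hg (show b + l + 1 < n by omega)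
      (show l + 1 ≤ b + l + 1 by omega)).1 t (by omega)
    rw [(isNeville_nevilleRow (revEntry g)).eq_sum (by omega),
      show b + l + 1 - (l + 1) = b by omega] at h1
    simp only [← mul_assoc]
    rw [← Finset.sum_mul]
    simp only [nevilleRow] at h1
    rw [h1, zero_mul]

theorem revEntry_mul_colMat (hg : solidMinor g ⟨⟨k, hk⟩, ⟨l, hl⟩⟩ ≠ 0) {b : ℕ}
    (h1 : k - l ≤ b) (h2 : b ≤ k) (a : ℕ) :
    revEntry (g * colMat g ⟨⟨k, hk⟩, ⟨l, hl⟩⟩) b a = revEntry g b a := by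
  rw [colMat, ← Matrix.mul_assoc]
  change revEntry (rowMat g ⟨⟨k, hk⟩, ⟨l, hl⟩⟩ * g) b a = revEntry g b a
  rw [revEntry_mul, Finset.sum_eq_single b]
  · rw [revEntry_rowMat_of_mem hk hl hg h1 h2, if_pos rfl, one_mul]
  · intro t _ ht
    rw [revEntry_rowMat_of_mem hk hl hg h1 h2, if_neg (Ne.symm ht), zero_mul]
  · intro h
    exact absurd (Finset.mem_range.mpr (by omega)) h

/-- `rowMat` is the identity on the rows of the minor, so right multiplication by `colMat` fixes
those rows of `g`, hence also their combinations `ρ k s` with `s ≤ l`. -/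
theorem sum_nevilleRow_mul_colMat (hg : ∀ c, solidMinor g c ≠ 0) {s : ℕ} (hs : s ≤ l) (a : ℕ) :
    ∑ j ∈ Finset.range n, nevilleRow (revEntry g) k s j *
      revEntry (colMat g ⟨⟨k, hk⟩, ⟨l, hl⟩⟩) j a = nevilleRow (revEntry g) k s a := by
  have h1 := fun c => (isNeville_nevilleRow (revEntry g)).eq_sum (show s ≤ k by omega) c
  simp only [nevilleRow] at h1
  simp only [h1, Finset.sum_mul]
  rw [Finset.sum_comm]
  refine Finset.sum_congr rfl fun e he => ?_
  have he := Finset.mem_range.mp he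
  simp only [mul_assoc]
  rw [← Finset.mul_sum, ← revEntry_mul, revEntry_mul_colMat hk hl (hg _) (by omega) (by omega)]

/-- `ρ k s` has no entries before column `s` and `colMat` has no rows after `l`; solving the
previous identity for row `s` leaves a triangular recursion. -/
theorem revEntry_colMat_eq (p : minorChart n) {s : ℕ} (hs : s ≤ l) (a : ℕ) :
    revEntry (colMat p.1.1 ⟨⟨k, hk⟩, ⟨l, hl⟩⟩) s a = unitRow k s a p -
      ∑ j ∈ Finset.Ioc s l, unitRow k s j p *
        revEntry (colMat p.1.1 ⟨⟨k, hk⟩, ⟨l, hl⟩⟩) j a := by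
  have h1 := sum_nevilleRow_mul_colMat hk hl p.2.2.2 hs a
  obtain ⟨h2, h3⟩ := nevilleRow_revEntry p.2.2.2 hk (show s ≤ k by omega)
  rw [← Finset.sum_subset (s₁ := Finset.Icc s l) (fun j hj => by
    have := Finset.mem_Icc.mp hj
    exact Finset.mem_range.mpr (by omega)) (fun j _ hj => by
    rcases lt_or_ge j s with h | h
    · rw [h2 j h, zero_mul]
    · rw [revEntry_colMat_of_gt hk hl (by
        by_contra h'
        exact hj (Finset.mem_Icc.mpr ⟨h, by omega⟩)), mul_zero]),
    ← Finset.Ioc_insert_left hs, Finset.sum_insert Finset.left_notMem_Ioc] at h1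
  simp only [unitRow]
  rw [← h1, add_div, mul_div_cancel_left₀ _ h3, Finset.sum_div]
  simp only [div_mul_eq_mul_div]
  ring

end

/-! ## Weights of the logarithmic derivatives -/

section

variable {n : ℕ} {ξ : GZIndex n → ℝ} {k l : ℕ} (hk : k < n) (hl : l < k + 1)

theorem rowMat_mem_boundedSpan_of_mem {b : ℕ} (h1 : k - l ≤ b) (h2 : b ≤ k) (a : ℕ) :
    (fun p : minorChart n => revEntry (rowMat p.1.1 ⟨⟨k, hk⟩, ⟨l, hl⟩⟩) b a) ∈ boundedSpan ξ := by
  have : (fun p : minorChart n => revEntry (rowMat p.1.1 ⟨⟨k, hk⟩, ⟨l, hl⟩⟩) b a) =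
      fun _ => if b = a then 1 else 0 :=
    funext fun p => revEntry_rowMat_of_mem hk hl (p.2.2.2 _) h1 h2 a
  rw [this]
  exact const_mem_boundedSpan ξ _

theorem revEntry_rowMat_eq {b : ℕ} (hb : b + l + 1 ≤ k) (a : ℕ) :
    (fun p : minorChart n => revEntry (rowMat p.1.1 ⟨⟨k, hk⟩, ⟨l, hl⟩⟩) b a) =
      -∑ e ∈ Finset.range (l + 1),
        (fun p : minorChart n => nevilleCoeff (nevilleMul (revEntry p.1.1)) (b + l + 1) (l + 1)
          (e + 1)) * fun p => revEntry (rowMat p.1.1 ⟨⟨k, hk⟩, ⟨l, hl⟩⟩) (b + (e + 1)) a := by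
  ext p
  have h := sum_nevilleCoeff_mul_rowMat hk hl p.2.2.2 hb a
  rw [Finset.sum_range_succ', nevilleCoeff_zero _ (by omega), one_mul, add_zero] at h
  simp only [Pi.neg_apply, Finset.sum_apply, Pi.mul_apply]
  linear_combination h

/-- Row `b` is a combination, with small coefficients, of rows of larger reversed index. The
threshold `b₀` is free because on a facet the row nearest the minor is only bounded, yet the rows
further away are still small. -/
theorem rowMat_mem_smallSpan_of_le {b₀ : ℕ} (hb₀ : b₀ + l + 1 ≤ k)
    (h : ∀ k' < b₀ + l + 1, ∀ l' ≤ l, l' ≤ k' → idxDiff ξ k' l' < idxDiff ξ (k' + 1) l')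
    (hbd : ∀ b, b₀ < b → b ≤ k → ∀ a,
      (fun p : minorChart n => revEntry (rowMat p.1.1 ⟨⟨k, hk⟩, ⟨l, hl⟩⟩) b a) ∈ boundedSpan ξ)
    {b : ℕ} (hb : b ≤ b₀) (a : ℕ) :
    (fun p : minorChart n => revEntry (rowMat p.1.1 ⟨⟨k, hk⟩, ⟨l, hl⟩⟩) b a) ∈ smallSpan ξ := by
  obtain ⟨d, rfl⟩ := Nat.exists_eq_add_of_le hb
  induction d using Nat.strong_induction_on generalizing b a with
  | _ d ih =>
    rw [revEntry_rowMat_eq hk hl (by omega)]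
    refine Submodule.neg_mem _ (Submodule.sum_mem _ fun e he => mul_mem_smallSpan ?_ ?_)
    · exact nevilleCoeff_mem_smallSpan (by omega) (by omega) (by omega)
        fun k' hk' l' hl' => h k' (by omega) l' (by omega)
    · have he := Finset.mem_range.mp he
      rcases lt_or_ge d (e + 1) with hd | hd
      · exact hbd _ (by omega) (by omega) a
      · have heq : b + d = b + (e + 1) + (d - (e + 1)) := by omega
        rw [heq] at hb₀ h hbd
        exact smallSpan_le_boundedSpan ξ (ih (d - (e + 1)) (by omega) a hb₀ h hbd (by omega))

theorem rowMat_mem_smallSpan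
    (h : ∀ k' < k, ∀ l' ≤ l, l' ≤ k' → idxDiff ξ k' l' < idxDiff ξ (k' + 1) l')
    {b : ℕ} (hb : b + l < k) (a : ℕ) :
    (fun p : minorChart n => revEntry (rowMat p.1.1 ⟨⟨k, hk⟩, ⟨l, hl⟩⟩) b a) ∈ smallSpan ξ :=
  rowMat_mem_smallSpan_of_le hk hl (b₀ := k - l - 1) (by omega)
    (fun k' hk' => h k' (by omega))
    (fun _ h1 h2 => rowMat_mem_boundedSpan_of_mem hk hl (by omega) h2) (by omega) a

theorem revEntry_colMat_eq_sub {s : ℕ} (hs : s ≤ l) (a : ℕ) :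
    (fun p : minorChart n => revEntry (colMat p.1.1 ⟨⟨k, hk⟩, ⟨l, hl⟩⟩) s a) = unitRow k s a -
      ∑ j ∈ Finset.Ioc s l, unitRow k s j *
        fun p => revEntry (colMat p.1.1 ⟨⟨k, hk⟩, ⟨l, hl⟩⟩) j a := by
  ext p
  simp only [Pi.sub_apply, Finset.sum_apply, Pi.mul_apply]
  exact revEntry_colMat_eq hk hl p hs a

theorem colMat_mem_boundedSpan
    (h : ∀ k' < k, ∀ l' ≤ k', idxDiff ξ (k' + 1) (l' + 1) ≤ idxDiff ξ k' l') (s a : ℕ) :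
    (fun p : minorChart n => revEntry (colMat p.1.1 ⟨⟨k, hk⟩, ⟨l, hl⟩⟩) s a) ∈ boundedSpan ξ := by
  induction hd : l + 1 - s using Nat.strong_induction_on generalizing s with
  | _ d ih =>
    rcases lt_or_ge l s with hs | hs
    · simp only [revEntry_colMat_of_gt hk hl hs]
      exact Submodule.zero_mem _
    · rw [revEntry_colMat_eq_sub hk hl hs]
      refine Submodule.sub_mem _ (unitRow_mem_boundedSpan hk (by omega)
        fun k' hk' l' _ => h k' hk' l') (Submodule.sum_mem _ fun j hj => mul_mem_boundedSpan
        (unitRow_mem_boundedSpan hk (by omega) fun k' hk' l' _ => h k' hk' l') ?_)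
      have := Finset.mem_Ioc.mp hj
      exact ih (l + 1 - j) (by omega) j rfl

/-- Both terms of the recursion for row `s` carry an off-pivot entry of `unitRow k s`, so strictness
in column `s` suffices; the later rows need only be bounded. -/
theorem colMat_mem_smallSpan
    (h : ∀ k' < k, ∀ l' ≤ k', idxDiff ξ (k' + 1) (l' + 1) ≤ idxDiff ξ k' l') {s a : ℕ}
    (hs : s ≤ l) (ha : l < a)
    (h' : ∀ k' < k, s ≤ k' → idxDiff ξ (k' + 1) (s + 1) < idxDiff ξ k' s) :
    (fun p : minorChart n => revEntry (colMat p.1.1 ⟨⟨k, hk⟩, ⟨l, hl⟩⟩) s a) ∈ smallSpan ξ := by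
  rw [revEntry_colMat_eq_sub hk hl hs]
  refine Submodule.sub_mem _ (unitRow_mem_smallSpan hk (by omega) (by omega)
    (fun k' hk' l' _ => h k' hk' l') h') (Submodule.sum_mem _ fun j hj => mul_mem_smallSpan
    (unitRow_mem_smallSpan hk (by omega) (Finset.mem_Ioc.mp hj).1
      (fun k' hk' l' _ => h k' hk' l') h') (colMat_mem_boundedSpan hk hl h j a))

end

/-! ## Logarithmic derivatives on a facet -/

/-- Leading term of the row just outside the minor `(k + 1, l)`. The next rows belong to the minor,
where `rowMat` is the identity, so the entries are minus the Neville coefficients of `(k + 1, l +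
1)`. Only the coefficient with index `1` contains the multiplier `(k, l)` without a small factor. -/
theorem rowMat_top_mem_smallSpan {n : ℕ} {ξ : GZIndex n → ℝ} {k l : ℕ} (hk : k + 1 < n)
    (hl : l < k + 1)
    (h : ∀ k' ≤ k, ∀ l' ≤ l, l' ≤ k' → ¬ (k' = k ∧ l' = l) →
      idxDiff ξ k' l' < idxDiff ξ (k' + 1) l')
    (h₀ : idxDiff ξ k l ≤ idxDiff ξ (k + 1) l) (a : ℕ) :
    (fun p : minorChart n =>
      revEntry (rowMat p.1.1 ⟨⟨k + 1, hk⟩, ⟨l, Nat.lt_succ_of_lt hl⟩⟩) (k - l) a -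
        if a = k - l + 1 then chartMonomial (mulExponent n k l) p else 0) ∈ smallSpan ξ := by
  have h1 : (fun p : minorChart n =>
      revEntry (rowMat p.1.1 ⟨⟨k + 1, hk⟩, ⟨l, Nat.lt_succ_of_lt hl⟩⟩) (k - l) a -
        if a = k - l + 1 then chartMonomial (mulExponent n k l) p else 0) =
      -∑ e ∈ Finset.range (l + 1), fun p : minorChart n =>
        if a = k - l + (e + 1) then nevilleCoeff (nevilleMul (revEntry p.1.1)) (k + 1) (l + 1)
          (e + 1) + (if e = 0 then chartMonomial (mulExponent n k l) p else 0) else 0 := by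
    ext p
    have h2 := congrFun (revEntry_rowMat_eq hk (Nat.lt_succ_of_lt hl)
      (show k - l + l + 1 ≤ k + 1 by omega) a) p
    simp only [Pi.neg_apply, Finset.sum_apply, Pi.mul_apply] at h2 ⊢
    rw [h2, show k - l + l + 1 = k + 1 by omega, sub_eq_add_neg, ← neg_add, neg_inj]
    have h3 : (if a = k - l + 1 then chartMonomial (mulExponent n k l) p else 0) =
        ∑ e ∈ Finset.range (l + 1), if a = k - l + (e + 1) then
          (if e = 0 then chartMonomial (mulExponent n k l) p else 0) else 0 := by
      rw [Finset.sum_eq_single 0]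
      · simp
      · intro e _ he
        simp [he]
      · simp
    rw [h3, ← Finset.sum_add_distrib]
    refine Finset.sum_congr rfl fun e he => ?_
    have he := Finset.mem_range.mp he
    rw [revEntry_rowMat_of_mem hk _ (p.2.2.2 _) (by omega) (by omega)]
    by_cases hae : a = k - l + (e + 1)
    · rw [if_pos hae, if_pos hae, if_pos hae.symm, mul_one]
    · rw [if_neg hae, if_neg hae, if_neg (Ne.symm hae), mul_zero, add_zero]
  rw [h1]
  refine Submodule.neg_mem _ (Submodule.sum_mem _ fun e he => ?_)
  have he := Finset.mem_range.mp he
  split_ifs with hae he0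
  · subst he0
    -- The recursion for the coefficient of index `1` subtracts the multiplier `(k, l)` times the
    -- leading coefficient `1`; adding it back leaves a coefficient of `(k, l)`, which is small.
    have h4 : (fun p : minorChart n => nevilleCoeff (nevilleMul (revEntry p.1.1)) (k + 1) (l + 1)
        (0 + 1) + chartMonomial (mulExponent n k l) p) =
        fun p => nevilleCoeff (nevilleMul (revEntry p.1.1)) k l (0 + 1) := by
      ext p
      simp only [nevilleCoeff]
      rw [nevilleCoeff_zero _ (by omega), nevilleMul_eq hk (by omega), mulExponent]
      ring
    rw [h4]
    exact nevilleCoeff_mem_smallSpan (by omega) (by omega) (by omega)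
      fun k' hk' l' hl' hlk => h k' (by omega) l' (by omega) hlk (by omega)
  · obtain ⟨e, rfl⟩ := Nat.exists_eq_succ_of_ne_zero he0
    simp only [nevilleCoeff, add_zero]
    refine Submodule.sub_mem _ (x := fun p : minorChart n =>
      nevilleCoeff (nevilleMul (revEntry p.1.1)) k l (e + 1 + 1)) (y := fun p : minorChart n =>
      nevilleMul (revEntry p.1.1) k l *
        nevilleCoeff (nevilleMul (revEntry p.1.1)) (k + 1) l (e + 1))
      (nevilleCoeff_mem_smallSpan (by omega) (by omega) (by omega)
        fun k' hk' l' hl' hlk => h k' (by omega) l' (by omega) hlk (by omega)) ?_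
    refine mul_mem_smallSpan' (φ := fun p : minorChart n => nevilleMul (revEntry p.1.1) k l)
      (χ := fun p : minorChart n =>
        nevilleCoeff (nevilleMul (revEntry p.1.1)) (k + 1) l (e + 1)) ?_
      (nevilleCoeff_mem_smallSpan hk (by omega) (by omega)
        fun k' hk' l' hl' hlk => h k' (by omega) l' (by omega) hlk (by omega))
    rw [nevilleMul_eq_chartMonomial hk (by omega)]
    refine chartMonomial_mem_laurentSpan ?_
    rw [Set.mem_ofPred_eq, coordWeight_mulExponent]
    exact sub_nonpos_of_le h₀
  · exact Submodule.zero_mem _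

/-- In the last row `l` the recursion has an empty sum, so the entry is that of `unitRow (k + 1) l`.
One step of `unitRow_succ` exposes `pivotRatio k l`, multiplied by a row that is `1` in column `l +
1` and small afterwards. -/
theorem colMat_top_mem_smallSpan {n : ℕ} {ξ : GZIndex n → ℝ} {k l : ℕ} (hk : k + 1 < n)
    (hl : l < k + 1) (h : ∀ k' ≤ k, ∀ l' ≤ k', idxDiff ξ (k' + 1) (l' + 1) ≤ idxDiff ξ k' l')
    (h' : ∀ k' < k, l ≤ k' → idxDiff ξ (k' + 1) (l + 1) < idxDiff ξ k' l)
    (h'' : ∀ k' ≤ k, l + 1 ≤ k' → idxDiff ξ (k' + 1) (l + 1 + 1) < idxDiff ξ k' (l + 1))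
    {a : ℕ} (ha : l < a) :
    (fun p : minorChart n =>
      revEntry (colMat p.1.1 ⟨⟨k + 1, hk⟩, ⟨l, Nat.lt_succ_of_lt hl⟩⟩) l a +
        if a = l + 1 then pivotRatio k l p else 0) ∈ smallSpan ξ := by
  have h1 : (fun p : minorChart n =>
      revEntry (colMat p.1.1 ⟨⟨k + 1, hk⟩, ⟨l, Nat.lt_succ_of_lt hl⟩⟩) l a +
        if a = l + 1 then pivotRatio k l p else 0) = unitRow k l a -
      pivotRatio k l * (unitRow (k + 1) (l + 1) a - fun _ => if a = l + 1 then 1 else 0) := by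
    ext p
    rw [revEntry_colMat_eq hk _ p le_rfl, Finset.Ioc_self, Finset.sum_empty, sub_zero,
      unitRow_succ hk (by omega)]
    simp only [Pi.sub_apply, Pi.mul_apply]
    split_ifs <;> ring
  rw [h1]
  refine Submodule.sub_mem _ (unitRow_mem_smallSpan (by omega) (by omega) ha
    (fun k' hk' l' _ => h k' (by omega) l') h') (mul_mem_smallSpan'
    (pivotRatio_mem_boundedSpan hk (by omega) (h k le_rfl l (by omega))) ?_)
  by_cases hal : a = l + 1
  · subst hal
    have h2 : (unitRow (k + 1) (l + 1) (l + 1) - fun _ => if l + 1 = l + 1 then 1 else 0 :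
        minorChart n → ℂ) = 0 := by
      rw [unitRow_self hk (by omega)]
      ext p
      simp
    rw [h2]
    exact Submodule.zero_mem _
  · have h2 : (unitRow (k + 1) (l + 1) a - fun _ => if a = l + 1 then 1 else 0 :
        minorChart n → ℂ) = unitRow (k + 1) (l + 1) a := by
      ext p
      simp [hal]
    rw [h2]
    exact unitRow_mem_smallSpan hk (by omega) (by omega) (fun k' hk' l' _ => h k' (by omega) l')
      fun k' hk' => h'' k' (by omega)

/-! ## The bracket in terms of logarithmic gradients -/

/-- The coefficients of the `r`-matrix. -/
def rCoeff {n : ℕ} (a b : Fin n) : ℂ := if a < b then 1 else if a = b then 1 / 2 else 0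

theorem rCoeff_add_swap {n : ℕ} (a b : Fin n) : rCoeff a b + rCoeff b a = 1 := by
  unfold rCoeff
  rcases lt_trichotomy a b with h | rfl | h
  · simp [h, h.not_gt, h.ne']
  · simp only [lt_irrefl, if_true, if_false]
    norm_num
  · simp [h, h.not_gt, h.ne']

theorem rMatrix_apply {n : ℕ} (a b c d : Fin n) :
    rMatrix n (a, b) (c, d) = if a = d ∧ b = c then rCoeff a b else 0 := by
  have h1 : (∑ i : Fin n, Matrix.single i i (1 : ℂ) ⊗ₖ Matrix.single i i (1 : ℂ)) (a, b) (c, d) =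
      if a = d ∧ b = c ∧ a = b then 1 else 0 := by
    rw [Matrix.sum_apply, Finset.sum_eq_single a]
    · simp only [Matrix.kroneckerMap_apply, Matrix.single_apply]
      grind
    · intro i _ hi
      simp [Matrix.kroneckerMap_apply, Matrix.single_apply, hi]
    · simp
  have h2 : (∑ i : Fin n, ∑ j : Fin n, if i < j then
      Matrix.single i j (1 : ℂ) ⊗ₖ Matrix.single j i (1 : ℂ) else 0) (a, b) (c, d) =
      if a = d ∧ b = c ∧ a < b then 1 else 0 := by
    rw [Matrix.sum_apply, Finset.sum_eq_single a, Matrix.sum_apply, Finset.sum_eq_single b]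
    · by_cases hab : a < b
      · simp only [hab, if_true, Matrix.kroneckerMap_apply, Matrix.single_apply]
        split_ifs <;> simp_all
      · simp [hab]
    · intro j _ hj
      by_cases hab : a < j
      · simp [hab, Matrix.kroneckerMap_apply, Matrix.single_apply, hj]
      · simp [hab]
    · simp
    · intro i _ hi
      rw [Matrix.sum_apply]
      refine Finset.sum_eq_zero fun j _ => ?_
      by_cases hab : i < j
      · simp [hab, Matrix.kroneckerMap_apply, Matrix.single_apply, hi]
      · simp [hab]
    · simp
  rw [rMatrix, Matrix.add_apply, Matrix.smul_apply, h1, h2, rCoeff]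
  rcases lt_trichotomy a b with h | rfl | h
  · simp [h, h.ne]
  · simp
  · simp [h.not_gt, h.ne']

theorem rCommutator_apply {n : ℕ} (A B : Mat n) (i s j t : Fin n) :
    rCommutator A B (i, s) (j, t) =
      rCoeff i s * A s j * B i t - rCoeff t j * A i t * B s j := by
  rw [rCommutator, ← Matrix.mul_kronecker_mul, Matrix.mul_one, Matrix.one_mul, Matrix.sub_apply,
    Matrix.mul_apply, Matrix.mul_apply, Finset.sum_eq_single (s, i),
    Finset.sum_eq_single (t, j)]
  · simp only [rMatrix_apply, Matrix.kroneckerMap_apply, and_self, if_true]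
    ring
  · rintro ⟨x, y⟩ _ h
    rw [rMatrix_apply, if_neg, mul_zero]
    rintro ⟨rfl, rfl⟩
    exact h rfl
  · simp
  · rintro ⟨x, y⟩ _ h
    rw [rMatrix_apply, if_neg, zero_mul]
    rintro ⟨rfl, rfl⟩
    exact h rfl
  · simp

/-- The pairing of two matrices with the `r`-matrix. -/
def rForm {n : ℕ} (M N : Mat n) : ℂ := ∑ i : Fin n, ∑ s : Fin n, rCoeff i s * (M s i * N i s)

/-- Up to its coefficients `r` is the flip of the tensor factors, so contracting the commutator with
two transposed gradients pairs the left products minus the right products. -/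
theorem sum_mul_rCommutator {n : ℕ} (P Q A B : Mat n) :
    ∑ i : Fin n, ∑ j : Fin n, ∑ s : Fin n, ∑ t : Fin n,
      P j i * Q t s * rCommutator A B (i, s) (j, t) =
      rForm (A * P) (B * Q) - rForm (P * A) (Q * B) := by
  simp only [rCommutator_apply, mul_sub, Finset.sum_sub_distrib, rForm, Matrix.mul_apply,
    Finset.sum_mul_sum]
  simp only [Finset.mul_sum]
  refine congrArg₂ (fun a b : ℂ => a - b) ?_ ?_
  · refine Finset.sum_congr rfl fun i _ => ?_
    rw [Finset.sum_comm]
    refine Finset.sum_congr rfl fun s _ => Finset.sum_congr rfl fun j _ =>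
      Finset.sum_congr rfl fun t _ => ?_
    ring
  · calc _ = ∑ j : Fin n, ∑ i : Fin n, ∑ t : Fin n, ∑ s : Fin n,
        P j i * Q t s * (rCoeff t j * A i t * B s j) := by
          rw [Finset.sum_comm]
          exact Finset.sum_congr rfl fun j _ => Finset.sum_congr rfl fun i _ => Finset.sum_comm
      _ = ∑ j : Fin n, ∑ t : Fin n, ∑ i : Fin n, ∑ s : Fin n,
        P j i * Q t s * (rCoeff t j * A i t * B s j) :=
          Finset.sum_congr rfl fun j _ => Finset.sum_comm
      _ = _ := by
          rw [Finset.sum_comm]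
          refine Finset.sum_congr rfl fun t _ => Finset.sum_congr rfl fun j _ =>
            Finset.sum_congr rfl fun i _ => Finset.sum_congr rfl fun s _ => ?_
          ring

theorem hasDerivAt_det_add_smul {m : Type*} [Fintype m] [DecidableEq m] {A : Matrix m m ℂ}
    (hA : A.det ≠ 0) (E : Matrix m m ℂ) :
    HasDerivAt (fun t : ℂ => (A + t • E).det) (A.det * (A⁻¹ * E).trace) 0 := by
  -- Factor out `A` and expand `det (1 + t M)` as `1 + t tr M` plus a polynomial multiple of `t ^
  -- 2`.
  have h1 : (fun t : ℂ => (A + t • E).det) = fun t => A.det * (1 + (A⁻¹ * E).trace * t +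
      (1 + (Polynomial.X : Polynomial ℂ) • (A⁻¹ * E).map ⇑Polynomial.C).det.divX.divX.eval t * t ^ 2) := by
    ext t
    rw [← Matrix.det_one_add_smul, ← Matrix.det_mul, mul_add, mul_one, mul_smul_comm,
      ← mul_assoc, Matrix.mul_nonsing_inv _ (isUnit_iff_ne_zero.mpr hA), one_mul]
  rw [h1]
  have h2 := ((((hasDerivAt_id (0 : ℂ)).const_mul (A⁻¹ * E).trace).const_add 1).add
    (((1 + (Polynomial.X : Polynomial ℂ) • (A⁻¹ * E).map ⇑Polynomial.C).det.divX.divX.hasDerivAt 0).mul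
      ((hasDerivAt_id (0 : ℂ)).pow 2))).const_mul A.det
  exact h2.congr_deriv (by simp)

theorem trace_inv_mul_submatrix_single {n : ℕ} (g : Mat n) (c : GZIndex n) (i j : Fin n) :
    ((g.submatrix (solidRow c) (solidCol c))⁻¹ *
      (Matrix.single i j (1 : ℂ)).submatrix (solidRow c) (solidCol c)).trace =
      logGrad g c j i := by
  simp only [Matrix.trace, Matrix.diag_apply, Matrix.mul_apply, logGrad, Matrix.submatrix_apply,
    id, Matrix.one_apply, Matrix.single_apply, Finset.sum_mul]
  rw [Finset.sum_comm]
  refine Finset.sum_congr rfl fun a _ => Finset.sum_congr rfl fun b _ => ?_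
  by_cases h1 : i = solidRow c a <;> by_cases h2 : j = solidCol c b <;>
    simp [h1, h2, eq_comm]

theorem derivG_solidMinor {n : ℕ} {p : Mat n × Mat n} {c : GZIndex n}
    (h : solidMinor p.1 c ≠ 0) (i j : Fin n) :
    derivG (coordFun (Sum.inl c)) p i j = solidMinor p.1 c * logGrad p.1 c j i := by
  rw [← trace_inv_mul_submatrix_single]
  exact (hasDerivAt_det_add_smul h _).deriv

theorem derivF_solidMinor {n : ℕ} (p : Mat n × Mat n) (c : GZIndex n) (i j : Fin n) :
    derivF (coordFun (Sum.inl c)) p i j = 0 := by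
  simp [derivF, coordFun]

theorem derivG_dualMinor {n : ℕ} (p : Mat n × Mat n) (c : {c : GZIndex n // ¬ IsRealIdx c})
    (i j : Fin n) : derivG (coordFun (Sum.inr c)) p i j = 0 := by
  simp [derivG, coordFun]

theorem isUnit_det_of_mem_dualGroup {n : ℕ} {p : Mat n × Mat n} (hp : p ∈ dualGroup n) :
    IsUnit p.1.det := by
  obtain ⟨hu, -, hd, h⟩ := hp
  rw [Matrix.det_of_isUpperTriangular (M := p.1) (fun i j hij => hu i j hij)]
  exact isUnit_iff_ne_zero.mpr
    (Finset.prod_ne_zero_iff.mpr fun i _ => left_ne_zero_of_mul (b := p.2 i i) (by simp [hd i]))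

theorem snd_mul_conjTranspose_fst {n : ℕ} {p : Mat n × Mat n} (hp : p ∈ dualGroup n) :
    p.2 * p.1ᴴ = 1 := by
  have h1 : p.2 = (p.1⁻¹)ᴴ := by rw [← hp.2.2.2, Matrix.conjTranspose_conjTranspose]
  rw [h1, ← Matrix.conjTranspose_mul, Matrix.mul_nonsing_inv _ (isUnit_det_of_mem_dualGroup hp),
    Matrix.conjTranspose_one]

/-- The Sherman–Morrison formula: the perturbation has rank one. -/
theorem inv_add_smul_single {n : ℕ} {f h : Mat n} (hf : f * h = 1) (i j : Fin n) {t : ℂ}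
    (ht : 1 + t * h j i ≠ 0) :
    (f + t • Matrix.single i j (1 : ℂ))⁻¹ =
      h + (-t / (1 + t * h j i)) • (h * Matrix.single i j (1 : ℂ) * h) := by
  refine Matrix.inv_eq_right_inv ?_
  have h1 : Matrix.single i j (1 : ℂ) * h * Matrix.single i j (1 : ℂ) =
      h j i • Matrix.single i j (1 : ℂ) := by
    rw [Matrix.single_mul_mul_single]
    simp [Matrix.smul_single]
  set E : Mat n := Matrix.single i j (1 : ℂ)
  have h2 : f * (h * E * h) = E * h := by
    rw [← Matrix.mul_assoc, ← Matrix.mul_assoc, hf, Matrix.one_mul]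
  have h3 : E * (h * E * h) = h j i • (E * h) := by
    rw [← Matrix.mul_assoc, ← Matrix.mul_assoc, h1, Matrix.smul_mul]
  set e : ℂ := h j i
  set s : ℂ := -t / (1 + t * e)
  have h4 : s + (t + t * (s * e)) = 0 := by
    simp only [s]
    field_simp
    ring
  calc (f + t • E) * (h + s • (h * E * h)) = 1 + (s + (t + t * (s * e))) • (E * h) := by
        rw [Matrix.add_mul, Matrix.mul_add, Matrix.mul_add, hf, Matrix.mul_smul, h2,
          Matrix.smul_mul, Matrix.smul_mul, Matrix.mul_smul, h3]
        module
    _ = 1 := by rw [h4, zero_smul, add_zero]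

/-- On the real form `p.2⁻¹` is the conjugate transpose of `p.1`, so perturbing `p.2` moves the
inverse along `-gᴴ E gᴴ` to first order. The derivative is taken in `p.2` freely, off the real form.
-/
theorem derivF_dualMinor {n : ℕ} {p : Mat n × Mat n} (hp : p ∈ dualGroup n)
    (c : {c : GZIndex n // ¬ IsRealIdx c}) (h : solidMinor p.1 c.1 ≠ 0) (i j : Fin n) :
    derivF (coordFun (Sum.inr c)) p i j =
      (starRingEnd ℂ) (solidMinor p.1 c.1) * (-(p.1 * logGrad p.1 c.1 * p.1)ᴴ) j i := by
  have hf := snd_mul_conjTranspose_fst hp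
  set E : Mat n := p.1ᴴ * Matrix.single i j (1 : ℂ) * p.1ᴴ
  have hA : (p.1ᴴ.submatrix (solidCol c.1) (solidRow c.1)).det =
      (starRingEnd ℂ) (solidMinor p.1 c.1) := by
    rw [← Matrix.conjTranspose_submatrix, Matrix.det_conjTranspose]
    rfl
  have hA0 : (p.1ᴴ.submatrix (solidCol c.1) (solidRow c.1)).det ≠ 0 := by
    rw [hA]
    exact (map_ne_zero _).mpr h
  have h1 : HasDerivAt (fun t : ℂ => -t / (1 + t * p.1ᴴ j i)) (-1) 0 := by
    have := (hasDerivAt_id (0 : ℂ)).neg.div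
      (((hasDerivAt_id (0 : ℂ)).mul_const (p.1ᴴ j i)).const_add 1) (by simp)
    exact this.congr_deriv (by simp)
  have h2 := (hasDerivAt_det_add_smul hA0 (E.submatrix (solidCol c.1) (solidRow c.1)))
  have h3 : HasDerivAt (fun t : ℂ => (p.1ᴴ.submatrix (solidCol c.1) (solidRow c.1) +
      (-t / (1 + t * p.1ᴴ j i)) • E.submatrix (solidCol c.1) (solidRow c.1)).det) _ 0 :=
    HasDerivAt.comp (0 : ℂ) (h₂ := fun t : ℂ => (p.1ᴴ.submatrix (solidCol c.1) (solidRow c.1) +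
      t • E.submatrix (solidCol c.1) (solidRow c.1)).det) (by simpa using h2) h1
  have h4 : (fun t : ℂ => coordFun (Sum.inr c) (p.1, p.2 + t • Matrix.single i j (1 : ℂ)))
      =ᶠ[nhds 0] fun t : ℂ => (p.1ᴴ.submatrix (solidCol c.1) (solidRow c.1) +
      (-t / (1 + t * p.1ᴴ j i)) • E.submatrix (solidCol c.1) (solidRow c.1)).det := by
    have hcont : Continuous fun t : ℂ => 1 + t * p.1ᴴ j i := by fun_prop
    filter_upwards [hcont.continuousAt.eventually_ne (show 1 + (0 : ℂ) * p.1ᴴ j i ≠ 0 by simp)]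
      with t ht
    simp only [coordFun, dualMinor]
    rw [inv_add_smul_single hf i j ht]
    rfl
  rw [derivF, h4.deriv_eq, h3.deriv, hA, mul_assoc]
  congr 1
  have h5 : ((p.1ᴴ.submatrix (solidCol c.1) (solidRow c.1))⁻¹ *
      E.submatrix (solidCol c.1) (solidRow c.1)).trace =
      ((logGrad p.1 c.1)ᴴ * E).trace := by
    have e1 : (logGrad p.1 c.1)ᴴ = (1 : Mat n).submatrix id (solidRow c.1) *
        ((p.1ᴴ.submatrix (solidCol c.1) (solidRow c.1))⁻¹ *
        (1 : Mat n).submatrix (solidCol c.1) id) := by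
      rw [logGrad, Matrix.conjTranspose_mul, Matrix.conjTranspose_mul,
        Matrix.conjTranspose_nonsing_inv]
      simp only [Matrix.conjTranspose_submatrix, Matrix.conjTranspose_one]
    have e2 : (1 : Mat n).submatrix (solidCol c.1) id * E *
        (1 : Mat n).submatrix id (solidRow c.1) = E.submatrix (solidCol c.1) (solidRow c.1) := by
      ext a b
      simp [Matrix.mul_apply, Matrix.one_apply]
    rw [← e2, e1, Matrix.mul_assoc ((1 : Mat n).submatrix id (solidRow c.1)),
      Matrix.trace_mul_comm ((1 : Mat n).submatrix id (solidRow c.1))]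
    simp only [Matrix.mul_assoc]
  rw [h5, ← Matrix.mul_assoc, Matrix.trace_mul_comm, ← Matrix.mul_assoc, ← Matrix.mul_assoc,
    Matrix.trace_mul_single]
  simp only [Matrix.neg_apply, Matrix.conjTranspose_mul]
  simp [Matrix.mul_assoc]

/-! ## Brackets of the coordinates -/

theorem rForm_neg_right {n : ℕ} (M N : Mat n) : rForm M (-N) = -rForm M N := by
  simp [rForm, Finset.sum_neg_distrib]

theorem rForm_neg_left {n : ℕ} (M N : Mat n) : rForm (-M) N = -rForm M N := by
  simp [rForm, Finset.sum_neg_distrib]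

theorem sum_smul_mul_rCommutator {n : ℕ} (P Q A B : Mat n) (a b : ℂ) :
    ∑ i : Fin n, ∑ j : Fin n, ∑ s : Fin n, ∑ t : Fin n,
      a * P j i * (b * Q t s) * rCommutator A B (i, s) (j, t) =
      a * b * (rForm (A * P) (B * Q) - rForm (P * A) (Q * B)) := by
  rw [← sum_mul_rCommutator]
  simp only [Finset.mul_sum]
  exact Finset.sum_congr rfl fun i _ => Finset.sum_congr rfl fun j _ =>
    Finset.sum_congr rfl fun s _ => Finset.sum_congr rfl fun t _ => by ring

theorem snd_mul_dualGrad {n : ℕ} {p : Mat n × Mat n} (hp : p ∈ dualGroup n) (c : GZIndex n) :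
    p.2 * -(p.1 * logGrad p.1 c * p.1)ᴴ = -(rowMat p.1 c)ᴴ := by
  rw [Matrix.mul_neg, Matrix.conjTranspose_mul, ← Matrix.mul_assoc, snd_mul_conjTranspose_fst hp,
    Matrix.one_mul]
  rfl

theorem dualGrad_mul_snd {n : ℕ} {p : Mat n × Mat n} (hp : p ∈ dualGroup n) (c : GZIndex n) :
    -(p.1 * logGrad p.1 c * p.1)ᴴ * p.2 = -(colMat p.1 c)ᴴ := by
  rw [Matrix.neg_mul, Matrix.mul_assoc, Matrix.conjTranspose_mul, Matrix.mul_assoc,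
    mul_eq_one_comm.mp (snd_mul_conjTranspose_fst hp), Matrix.mul_one]
  rfl

theorem complexBracket_inl_inl {n : ℕ} (p : minorChart n) (c d : GZIndex n) :
    complexBracket (coordFun (Sum.inl c)) (coordFun (Sum.inl d)) p.1 =
      solidMinor p.1.1 c * solidMinor p.1.1 d *
        (rForm (rowMat p.1.1 c) (rowMat p.1.1 d) - rForm (colMat p.1.1 c) (colMat p.1.1 d)) := by
  simp only [complexBracket, derivF_solidMinor, derivG_solidMinor (p.2.2.2 _), zero_mul, mul_zero,
    add_zero, sub_zero]
  exact sum_smul_mul_rCommutator _ _ _ _ _ _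

theorem complexBracket_inl_inr {n : ℕ} (p : minorChart n) (c : GZIndex n)
    (d : {d : GZIndex n // ¬ IsRealIdx d}) :
    complexBracket (coordFun (Sum.inl c)) (coordFun (Sum.inr d)) p.1 =
      solidMinor p.1.1 c * (starRingEnd ℂ) (solidMinor p.1.1 d.1) *
        (rForm (colMat p.1.1 c) (colMat p.1.1 d.1)ᴴ -
          rForm (rowMat p.1.1 c) (rowMat p.1.1 d.1)ᴴ) := by
  simp only [complexBracket, derivF_solidMinor, derivG_solidMinor (p.2.2.2 _), derivG_dualMinor,
    derivF_dualMinor p.2.1 _ (p.2.2.2 _), zero_mul, mul_zero, add_zero, sub_zero, zero_add]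
  rw [sum_smul_mul_rCommutator, snd_mul_dualGrad p.2.1, dualGrad_mul_snd p.2.1, rForm_neg_right,
    rForm_neg_right, ← neg_sub, sub_neg_eq_add, neg_add_eq_sub, neg_sub]
  rfl

theorem complexBracket_inr_inl {n : ℕ} (p : minorChart n) (c : GZIndex n)
    (d : {d : GZIndex n // ¬ IsRealIdx d}) :
    complexBracket (coordFun (Sum.inr d)) (coordFun (Sum.inl c)) p.1 =
      -complexBracket (coordFun (Sum.inl c)) (coordFun (Sum.inr d)) p.1 := by
  simp only [complexBracket, derivF_solidMinor, derivG_dualMinor, zero_mul, mul_zero,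
    add_zero, sub_zero, zero_add, zero_sub, Finset.sum_neg_distrib]
  rw [neg_inj]
  calc _ = ∑ s : Fin n, ∑ i : Fin n, ∑ j : Fin n, ∑ t : Fin n,
        derivF (coordFun (Sum.inr d)) p.1 i j * derivG (coordFun (Sum.inl c)) p.1 s t *
          rCommutator p.1.1 p.1.2 (s, i) (t, j) := by
        rw [Finset.sum_comm]
        refine (Finset.sum_congr rfl fun j _ => Finset.sum_comm).trans ?_
        rw [Finset.sum_comm]
        refine Finset.sum_congr rfl fun s _ => Finset.sum_comm
    _ = _ := by
        refine Finset.sum_congr rfl fun s _ => ?_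
        refine (Finset.sum_congr rfl fun i _ => Finset.sum_comm).trans ?_
        rw [Finset.sum_comm]
        refine Finset.sum_congr rfl fun t _ => Finset.sum_congr rfl fun i _ =>
          Finset.sum_congr rfl fun j _ => ?_
        ring

theorem complexBracket_inr_inr {n : ℕ} (p : minorChart n)
    (c d : {d : GZIndex n // ¬ IsRealIdx d}) :
    complexBracket (coordFun (Sum.inr c)) (coordFun (Sum.inr d)) p.1 =
      (starRingEnd ℂ) (solidMinor p.1.1 c.1) * (starRingEnd ℂ) (solidMinor p.1.1 d.1) *
        (rForm (rowMat p.1.1 c.1)ᴴ (rowMat p.1.1 d.1)ᴴ -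
          rForm (colMat p.1.1 c.1)ᴴ (colMat p.1.1 d.1)ᴴ) := by
  simp only [complexBracket, derivG_dualMinor,
    derivF_dualMinor p.2.1 _ (p.2.2.2 _), zero_mul, mul_zero, add_zero, sub_zero, zero_add]
  rw [sum_smul_mul_rCommutator]
  simp only [snd_mul_dualGrad p.2.1, dualGrad_mul_snd p.2.1, rForm_neg_right, rForm_neg_left,
    neg_neg]

/-! ## Log-canonical brackets -/

/-- `r` sees only the pairs `i ≤ s`, the diagonal with weight one half. Here the hypothesis kills
the off-diagonal part that it sees; in `rForm_of_lower` it kills the part not seen, so the full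
trace enters. -/
theorem rForm_of_upper {n : ℕ} {M N : Mat n} (h : ∀ i s, i < s → M s i * N i s = 0) :
    rForm M N = ∑ i, 1 / 2 * (M i i * N i i) := by
  refine Finset.sum_congr rfl fun i _ => ?_
  rw [Finset.sum_eq_single i]
  · simp [rCoeff]
  · intro s _ hs
    rcases lt_or_gt_of_ne hs with h' | h'
    · simp [rCoeff, h'.not_gt, h'.ne']
    · rw [h i s h', mul_zero]
  · simp

theorem rForm_of_lower {n : ℕ} {M N : Mat n} (h : ∀ i s, s < i → M s i * N i s = 0) :
    rForm M N = (M * N).trace - ∑ i, 1 / 2 * (M i i * N i i) := by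
  have h1 : (M * N).trace = ∑ i, ∑ s, M s i * N i s := by
    rw [Finset.sum_comm]
    rfl
  rw [h1, ← Finset.sum_sub_distrib]
  refine Finset.sum_congr rfl fun i _ => ?_
  rw [eq_sub_iff_add_eq, ← Finset.sum_erase_add _ _ (Finset.mem_univ i),
    ← Finset.sum_erase_add _ (fun s => M s i * N i s) (Finset.mem_univ i), add_assoc]
  congr 1
  · refine Finset.sum_congr rfl fun s hs => ?_
    rcases lt_or_gt_of_ne (Finset.ne_of_mem_erase hs) with h' | h'
    · rw [h i s h', mul_zero]
    · simp [rCoeff, h']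
  · simp only [rCoeff, lt_irrefl, if_true, if_false]
    ring

/-- Transposition exchanges the two tensor factors, and `r` plus its flip has all coefficients `1`,
which yields the trace. -/
theorem rForm_conjTranspose {n : ℕ} (M N : Mat n) :
    rForm Mᴴ Nᴴ = (starRingEnd ℂ) ((M * N).trace - rForm M N) := by
  have h1 : (M * N).trace = ∑ s, ∑ i, M s i * N i s := rfl
  rw [h1, rForm, rForm, Finset.sum_comm (f := fun i s => rCoeff i s * (M s i * N i s)),
    ← Finset.sum_sub_distrib, map_sum]
  refine Finset.sum_congr rfl fun s _ => ?_
  rw [← Finset.sum_sub_distrib, map_sum]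
  refine Finset.sum_congr rfl fun i _ => ?_
  have h2 : (starRingEnd ℂ) (rCoeff s i) = rCoeff s i := by
    unfold rCoeff
    split_ifs <;> simp [Complex.conj_ofNat]
  have h3 := rCoeff_add_swap s i
  rw [show M s i * N i s - rCoeff i s * (M s i * N i s) = rCoeff s i * (M s i * N i s) by
    linear_combination (-(M s i * N i s)) * h3, map_mul, map_mul, h2]
  rfl

/-- The indicator function of the columns of a solid minor. -/
def colIndicator {n : ℕ} (c : GZIndex n) (i : Fin n) : ℂ :=
  if n - (c.2.val + 1) ≤ i then 1 else 0

/-- The indicator function of the rows of a solid minor. -/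
def rowIndicator {n : ℕ} (c : GZIndex n) (i : Fin n) : ℂ :=
  if n - (c.1.val + 1) ≤ i ∧ (i : ℕ) ≤ n - (c.1.val + 1) + c.2.val then 1 else 0

theorem colMat_eq_zero_of_lt {n : ℕ} (g : Mat n) (c : GZIndex n) {i : Fin n}
    (h : (i : ℕ) < n - (c.2.val + 1)) (j : Fin n) : colMat g c i j = 0 := by
  refine colMat_apply_eq_zero g c (fun a ha => ?_) j
  have := congrArg Fin.val ha
  simp only [solidCol] at this
  omega

theorem colMat_eq_one_apply {n : ℕ} {g : Mat n} {c : GZIndex n} (hg : solidMinor g c ≠ 0)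
    {j : Fin n} (h : n - (c.2.val + 1) ≤ j) (i : Fin n) : colMat g c i j = (1 : Mat n) i j := by
  obtain ⟨a, rfl⟩ := exists_solidCol_eq c j h
  exact colMat_apply_solidCol hg i a

theorem rowMat_eq_zero_of_notMem {n : ℕ} (g : Mat n) (c : GZIndex n) {j : Fin n}
    (h : ¬ (n - (c.1.val + 1) ≤ j ∧ (j : ℕ) ≤ n - (c.1.val + 1) + c.2.val)) (i : Fin n) :
    rowMat g c i j = 0 := by
  refine rowMat_apply_eq_zero g c (fun a ha => ?_) i
  have := congrArg Fin.val ha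
  have := a.isLt
  simp only [solidRow] at *
  omega

theorem rowMat_eq_one_apply {n : ℕ} {g : Mat n} {c : GZIndex n} (hg : solidMinor g c ≠ 0)
    {i : Fin n} (h : n - (c.1.val + 1) ≤ i ∧ (i : ℕ) ≤ n - (c.1.val + 1) + c.2.val)
    (j : Fin n) : rowMat g c i j = (1 : Mat n) i j := by
  obtain ⟨a, rfl⟩ := exists_solidRow_eq c i h.1 h.2
  exact rowMat_apply_solidRow hg a j

theorem colMat_self {n : ℕ} {g : Mat n} {c : GZIndex n} (hg : solidMinor g c ≠ 0) (i : Fin n) :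
    colMat g c i i = colIndicator c i := by
  unfold colIndicator
  split_ifs with h
  · rw [colMat_eq_one_apply hg h, Matrix.one_apply_eq]
  · exact colMat_eq_zero_of_lt g c (by omega) i

theorem rowMat_self {n : ℕ} {g : Mat n} {c : GZIndex n} (hg : solidMinor g c ≠ 0) (i : Fin n) :
    rowMat g c i i = rowIndicator c i := by
  unfold rowIndicator
  split_ifs with h
  · rw [rowMat_eq_one_apply hg h, Matrix.one_apply_eq]
  · exact rowMat_eq_zero_of_notMem g c h i

/-- An off-diagonal entry of `colMat` needs its row inside and its column outside the column set of
the minor. These sets are final segments, hence nested, so the two requirements exclude each other.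
-/
theorem colMat_mul_colMat_eq_zero {n : ℕ} {g : Mat n} (hg : ∀ c, solidMinor g c ≠ 0)
    (c d : GZIndex n) {i s : Fin n} (h : s ≠ i) : colMat g c s i * colMat g d i s = 0 := by
  by_cases h1 : n - (c.2.val + 1) ≤ i
  · rw [colMat_eq_one_apply (hg c) h1, Matrix.one_apply_ne h, zero_mul]
  by_cases h2 : n - (d.2.val + 1) ≤ s
  · rw [colMat_eq_one_apply (hg d) h2, Matrix.one_apply_ne h.symm, mul_zero]
  by_cases h3 : (s : ℕ) < n - (c.2.val + 1)
  · rw [colMat_eq_zero_of_lt g c h3, zero_mul]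
  · rw [colMat_eq_zero_of_lt g d (by omega), mul_zero]

/-- A nonzero product forces `i` to be a row of `c` but not of `d`, and `s` a row of `d` but not of
`c`. -/
theorem rowMat_mul_rowMat_eq_zero {n : ℕ} {g : Mat n} (hg : ∀ c, solidMinor g c ≠ 0)
    (c d : GZIndex n) {i s : Fin n} (h : s ≠ i)
    (h' : ¬ ((n - (c.1.val + 1) ≤ i ∧ (i : ℕ) ≤ n - (c.1.val + 1) + c.2.val) ∧
      ¬ (n - (c.1.val + 1) ≤ s ∧ (s : ℕ) ≤ n - (c.1.val + 1) + c.2.val) ∧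
      (n - (d.1.val + 1) ≤ s ∧ (s : ℕ) ≤ n - (d.1.val + 1) + d.2.val) ∧
      ¬ (n - (d.1.val + 1) ≤ i ∧ (i : ℕ) ≤ n - (d.1.val + 1) + d.2.val))) :
    rowMat g c s i * rowMat g d i s = 0 := by
  by_cases h1 : n - (c.1.val + 1) ≤ i ∧ (i : ℕ) ≤ n - (c.1.val + 1) + c.2.val
  · by_cases h2 : n - (c.1.val + 1) ≤ s ∧ (s : ℕ) ≤ n - (c.1.val + 1) + c.2.val
    · rw [rowMat_eq_one_apply (hg c) h2, Matrix.one_apply_ne h, zero_mul]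
    by_cases h3 : n - (d.1.val + 1) ≤ s ∧ (s : ℕ) ≤ n - (d.1.val + 1) + d.2.val
    · by_cases h4 : n - (d.1.val + 1) ≤ i ∧ (i : ℕ) ≤ n - (d.1.val + 1) + d.2.val
      · rw [rowMat_eq_one_apply (hg d) h4, Matrix.one_apply_ne h.symm, mul_zero]
      · exact absurd ⟨h1, h2, h3, h4⟩ h'
    · rw [rowMat_eq_zero_of_notMem g d h3, mul_zero]
  · rw [rowMat_eq_zero_of_notMem g c h1, zero_mul]

theorem trace_colMat_mul_colMat {n : ℕ} {g : Mat n} (hg : ∀ c, solidMinor g c ≠ 0)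
    (c d : GZIndex n) :
    (colMat g c * colMat g d).trace = ∑ i, colIndicator c i * colIndicator d i := by
  refine Finset.sum_congr rfl fun i _ => ?_
  rw [Matrix.diag_apply, Matrix.mul_apply, Finset.sum_eq_single i]
  · rw [colMat_self (hg c), colMat_self (hg d)]
  · intro s _ hs
    exact colMat_mul_colMat_eq_zero hg c d hs.symm
  · simp

theorem exists_rForm_sub_eq {n : ℕ} (c d : GZIndex n) :
    ∃ κ : ℂ, ∀ p : minorChart n,
      rForm (rowMat p.1.1 c) (rowMat p.1.1 d) - rForm (colMat p.1.1 c) (colMat p.1.1 d) = κ := by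
  have hcol : ∀ p : minorChart n, rForm (colMat p.1.1 c) (colMat p.1.1 d) =
      ∑ i, 1 / 2 * (colIndicator c i * colIndicator d i) := fun p => by
    rw [rForm_of_upper fun i s h => colMat_mul_colMat_eq_zero p.2.2.2 c d h.ne']
    exact Finset.sum_congr rfl fun i _ => by rw [colMat_self (p.2.2.2 c), colMat_self (p.2.2.2 d)]
  have hdiag : ∀ p : minorChart n, ∑ i, 1 / 2 * (rowMat p.1.1 c i i * rowMat p.1.1 d i i) =
      ∑ i, 1 / 2 * (rowIndicator c i * rowIndicator d i) := fun p =>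
    Finset.sum_congr rfl fun i _ => by rw [rowMat_self (p.2.2.2 c), rowMat_self (p.2.2.2 d)]
  -- The row sets are intervals. If that of `c` begins and ends no later than that of `d`, the
  -- surviving products have `i < s`; otherwise any that survive have `s < i`.
  by_cases h : n - (c.1.val + 1) ≤ n - (d.1.val + 1) ∧
      n - (c.1.val + 1) + c.2.val ≤ n - (d.1.val + 1) + d.2.val
  · refine ⟨∑ i, colIndicator c i * colIndicator d i -
      ∑ i, 1 / 2 * (rowIndicator c i * rowIndicator d i) -
      ∑ i, 1 / 2 * (colIndicator c i * colIndicator d i), fun p => ?_⟩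
    rw [hcol, rForm_of_lower fun i s hs =>
      rowMat_mul_rowMat_eq_zero p.2.2.2 c d hs.ne (by have : (s : ℕ) < i := hs; omega), hdiag,
      trace_rowMat_mul_rowMat, trace_colMat_mul_colMat p.2.2.2]
  · refine ⟨∑ i, 1 / 2 * (rowIndicator c i * rowIndicator d i) -
      ∑ i, 1 / 2 * (colIndicator c i * colIndicator d i), fun p => ?_⟩
    rw [hcol, rForm_of_upper fun i s hs =>
      rowMat_mul_rowMat_eq_zero p.2.2.2 c d hs.ne' (by have : (i : ℕ) < s := hs; omega), hdiag]

theorem exists_rForm_conjTranspose_sub_eq {n : ℕ} (c d : GZIndex n) :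
    ∃ κ : ℂ, ∀ p : minorChart n,
      rForm (rowMat p.1.1 c)ᴴ (rowMat p.1.1 d)ᴴ - rForm (colMat p.1.1 c)ᴴ (colMat p.1.1 d)ᴴ =
        κ := by
  obtain ⟨κ, hκ⟩ := exists_rForm_sub_eq c d
  refine ⟨-(starRingEnd ℂ) κ, fun p => ?_⟩
  rw [rForm_conjTranspose, rForm_conjTranspose, trace_rowMat_mul_rowMat, ← hκ p, ← map_sub,
    ← map_neg]
  congr 1
  ring

/-! ## Mixed brackets -/

theorem rForm_conjTranspose_right {n : ℕ} (M N : Mat n) :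
    rForm M Nᴴ = ∑ i, 1 / 2 * (M i i * (starRingEnd ℂ) (N i i)) +
      ∑ i, ∑ s, if i < s then M s i * (starRingEnd ℂ) (N s i) else 0 := by
  rw [rForm, ← Finset.sum_add_distrib]
  refine Finset.sum_congr rfl fun i _ => ?_
  rw [← Finset.add_sum_erase _ _ (Finset.mem_univ i),
    ← Finset.add_sum_erase _ (fun s => if i < s then _ else _) (Finset.mem_univ i)]
  have h1 : ∀ s ∈ Finset.univ.erase i, rCoeff i s * (M s i * Nᴴ i s) =
      if i < s then M s i * (starRingEnd ℂ) (N s i) else 0 := fun s hs => by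
    simp only [rCoeff, (Finset.ne_of_mem_erase hs).symm, if_false, ite_mul, one_mul, zero_mul]
    rfl
  rw [Finset.sum_congr rfl h1]
  simp [rCoeff]

/-- The coefficient of the log-canonical term in a mixed bracket. -/
def mixedConst {n : ℕ} (c d : GZIndex n) : ℂ :=
  ∑ i, 1 / 2 * (colIndicator c i * colIndicator d i) -
    ∑ i, 1 / 2 * (rowIndicator c i * rowIndicator d i)

/-- The off-diagonal part of the pairing of column operations. -/
def colOffDiag {n : ℕ} (c d : GZIndex n) : minorChart n → ℂ :=
  ∑ i, ∑ s, if i < s then (fun p => colMat p.1.1 c s i) * star (fun p => colMat p.1.1 d s i) else 0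

/-- The off-diagonal part of the pairing of row operations. -/
def rowOffDiag {n : ℕ} (c d : GZIndex n) : minorChart n → ℂ :=
  ∑ i, ∑ s, if i < s then (fun p => rowMat p.1.1 c s i) * star (fun p => rowMat p.1.1 d s i) else 0

theorem mixed_eq {n : ℕ} (c d : GZIndex n) (p : minorChart n) :
    rForm (colMat p.1.1 c) (colMat p.1.1 d)ᴴ - rForm (rowMat p.1.1 c) (rowMat p.1.1 d)ᴴ =
      mixedConst c d + colOffDiag c d p - rowOffDiag c d p := by
  have h1 : ∀ i, (starRingEnd ℂ) (colIndicator d i) = colIndicator d i := fun i => by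
    unfold colIndicator
    split_ifs <;> simp
  have h2 : ∀ i, (starRingEnd ℂ) (rowIndicator d i) = rowIndicator d i := fun i => by
    unfold rowIndicator
    split_ifs <;> simp
  have h3 : colOffDiag c d p = ∑ i, ∑ s, if i < s then
      colMat p.1.1 c s i * (starRingEnd ℂ) (colMat p.1.1 d s i) else 0 := by
    simp only [colOffDiag, Finset.sum_apply]
    refine Finset.sum_congr rfl fun i _ => Finset.sum_congr rfl fun s _ => ?_
    split_ifs <;> rfl
  have h4 : rowOffDiag c d p = ∑ i, ∑ s, if i < s then
      rowMat p.1.1 c s i * (starRingEnd ℂ) (rowMat p.1.1 d s i) else 0 := by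
    simp only [rowOffDiag, Finset.sum_apply]
    refine Finset.sum_congr rfl fun i _ => Finset.sum_congr rfl fun s _ => ?_
    split_ifs <;> rfl
  rw [rForm_conjTranspose_right, rForm_conjTranspose_right, h3, h4]
  simp only [colMat_self (p.2.2.2 _), rowMat_self (p.2.2.2 _), h1, h2, mixedConst]
  ring

/-- The inequalities `λ^(k) > λ^(k-1)` between the differences of `ξ`. -/
def RowStrict {n : ℕ} (ξ : GZIndex n → ℝ) : Prop :=
  ∀ k l, k + 1 < n → l ≤ k → idxDiff ξ k l < idxDiff ξ (k + 1) l

/-- The inequalities `λ^(k-1)_l > λ^(k)_(l+1)` between the differences of `ξ`. -/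
def ColStrict {n : ℕ} (ξ : GZIndex n → ℝ) : Prop :=
  ∀ k l, k + 1 < n → l ≤ k → idxDiff ξ (k + 1) (l + 1) < idxDiff ξ k l

theorem sum_offDiag_mem_smallSpan {n : ℕ} {ξ : GZIndex n → ℝ}
    {F H : Fin n → Fin n → minorChart n → ℂ}
    (hF : ∀ i s, i < s → F s i ∈ smallSpan ξ) (hH : ∀ i s, i < s → H s i ∈ smallSpan ξ) :
    (∑ i, ∑ s, if i < s then F s i * star (H s i) else 0) ∈ smallSpan ξ := by
  refine Submodule.sum_mem _ fun i _ => Submodule.sum_mem _ fun s _ => ?_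
  split_ifs with h
  · exact mul_mem_smallSpan (hF i s h)
      (smallSpan_le_boundedSpan ξ (star_mem_smallSpan (hH i s h)))
  · exact Submodule.zero_mem _

/-- If a single entry has a bounded leading part and all others are small, the sum of square moduli
equals that of the leading part up to small terms. -/
theorem sum_offDiag_sub_mem_smallSpan {n : ℕ} {ξ : GZIndex n → ℝ}
    {F : Fin n → Fin n → minorChart n → ℂ} {i₀ s₀ : Fin n} (h₀ : i₀ < s₀)
    {φ : minorChart n → ℂ} (hφ : φ ∈ boundedSpan ξ)
    (hF₀ : F s₀ i₀ - φ ∈ smallSpan ξ)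
    (hF : ∀ i s, i < s → ¬ (i = i₀ ∧ s = s₀) → F s i ∈ smallSpan ξ) :
    (∑ i, ∑ s, if i < s then F s i * star (F s i) else 0) - φ * star φ ∈ smallSpan ξ := by
  have h1 : φ * star φ = ∑ i, ∑ s, if i = i₀ ∧ s = s₀ then φ * star φ else 0 := by
    rw [Finset.sum_eq_single i₀, Finset.sum_eq_single s₀]
    · simp
    · intro s _ hs; simp [hs]
    · simp
    · intro i _ hi; simp [hi]
    · simp
  rw [h1, ← Finset.sum_sub_distrib]
  refine Submodule.sum_mem _ fun i _ => ?_
  rw [← Finset.sum_sub_distrib]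
  refine Submodule.sum_mem _ fun s _ => ?_
  by_cases his : i = i₀ ∧ s = s₀
  · obtain ⟨rfl, rfl⟩ := his
    rw [if_pos h₀, if_pos ⟨rfl, rfl⟩]
    have h2 : F s i * star (F s i) - φ * star φ =
        (F s i - φ) * star (F s i - φ) + (F s i - φ) * star φ + φ * star (F s i - φ) := by
      rw [star_sub]; ring
    rw [h2]
    exact Submodule.add_mem _ (Submodule.add_mem _
      (mul_mem_smallSpan hF₀ (smallSpan_le_boundedSpan ξ (star_mem_smallSpan hF₀)))
      (mul_mem_smallSpan hF₀ (star_mem_boundedSpan hφ)))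
      (mul_mem_smallSpan' hφ (star_mem_smallSpan hF₀))
  · rw [if_neg his, sub_zero]
    split_ifs with h
    · exact mul_mem_smallSpan (hF i s h his)
        (smallSpan_le_boundedSpan ξ (star_mem_smallSpan (hF i s h his)))
    · exact Submodule.zero_mem _

theorem rowMat_apply_eq_zero_or {n : ℕ} (p : minorChart n) {k l : ℕ} (hk : k < n)
    (hl : l < k + 1) {i s : Fin n} (h : i < s) (hs : k ≤ n - 1 - s + l) :
    rowMat p.1.1 ⟨⟨k, hk⟩, ⟨l, hl⟩⟩ s i = 0 := by
  have h' : (i : ℕ) < s := h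
  have := s.isLt
  by_cases h1 : n - 1 - s ≤ k
  · rw [rowMat_eq_one_apply (p.2.2.2 _) (by simp only; omega), Matrix.one_apply_ne h.ne']
  · exact rowMat_eq_zero_of_notMem _ _ (by simp only; omega) _

theorem rowMat_offDiag_mem_smallSpan {n : ℕ} {ξ : GZIndex n → ℝ} (hξ : RowStrict ξ)
    (c : GZIndex n) {i s : Fin n} (h : i < s) :
    (fun p : minorChart n => rowMat p.1.1 c s i) ∈ smallSpan ξ := by
  obtain ⟨⟨k, hk⟩, ⟨l, hl⟩⟩ := c
  have hl' : l < k + 1 := hl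
  rcases lt_or_ge (n - 1 - (s : ℕ) + l) k with hs | hs
  · have h1 := rowMat_mem_smallSpan (ξ := ξ) hk hl
      (fun k' hk' l' _ h' => hξ k' l' (by omega) h') hs (n - 1 - i)
    simpa only [revEntry_rev] using h1
  · have h1 : (fun p : minorChart n => rowMat p.1.1 ⟨⟨k, hk⟩, ⟨l, hl⟩⟩ s i) = 0 :=
      funext fun p => rowMat_apply_eq_zero_or p hk hl h hs
    rw [h1]
    exact Submodule.zero_mem _

theorem colMat_apply_eq_zero_or {n : ℕ} (p : minorChart n) {k l : ℕ} (hk : k < n)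
    (hl : l < k + 1) {i s : Fin n} (h : i < s) (hs : n - 1 - i ≤ l ∨ l < n - 1 - s) :
    colMat p.1.1 ⟨⟨k, hk⟩, ⟨l, hl⟩⟩ s i = 0 := by
  rcases hs with hs | hs
  · rw [colMat_eq_one_apply (p.2.2.2 _) (by simp only; omega), Matrix.one_apply_ne h.ne']
  · exact colMat_eq_zero_of_lt _ _ (by simp only; omega) _

theorem colMat_offDiag_mem_smallSpan {n : ℕ} {ξ : GZIndex n → ℝ} (hξ : ColStrict ξ)
    (c : GZIndex n) {i s : Fin n} (h : i < s) :
    (fun p : minorChart n => colMat p.1.1 c s i) ∈ smallSpan ξ := by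
  obtain ⟨⟨k, hk⟩, ⟨l, hl⟩⟩ := c
  by_cases hs : n - 1 - i ≤ l ∨ l < n - 1 - s
  · have h1 : (fun p : minorChart n => colMat p.1.1 ⟨⟨k, hk⟩, ⟨l, hl⟩⟩ s i) = 0 :=
      funext fun p => colMat_apply_eq_zero_or p hk hl h hs
    rw [h1]
    exact Submodule.zero_mem _
  · have h1 := colMat_mem_smallSpan (ξ := ξ) hk hl
      (fun k' hk' l' h' => (hξ k' l' (by omega) h').le) (s := n - 1 - s) (a := n - 1 - i)
      (by omega) (by omega) (fun k' hk' h' => hξ k' _ (by omega) h')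
    simpa only [revEntry_rev] using h1

theorem rowOffDiag_mem_smallSpan {n : ℕ} {ξ : GZIndex n → ℝ} (hξ : RowStrict ξ)
    (c d : GZIndex n) : rowOffDiag c d ∈ smallSpan ξ :=
  sum_offDiag_mem_smallSpan (F := fun s i p => rowMat p.1.1 c s i)
    (H := fun s i p => rowMat p.1.1 d s i)
    (fun _ _ h => rowMat_offDiag_mem_smallSpan hξ c h)
    (fun _ _ h => rowMat_offDiag_mem_smallSpan hξ d h)

theorem colOffDiag_mem_smallSpan {n : ℕ} {ξ : GZIndex n → ℝ} (hξ : ColStrict ξ)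
    (c d : GZIndex n) : colOffDiag c d ∈ smallSpan ξ :=
  sum_offDiag_mem_smallSpan (F := fun s i p => colMat p.1.1 c s i)
    (H := fun s i p => colMat p.1.1 d s i)
    (fun _ _ h => colMat_offDiag_mem_smallSpan hξ c h)
    (fun _ _ h => colMat_offDiag_mem_smallSpan hξ d h)

theorem rowOffDiag_sub_mem_smallSpan {n : ℕ} {ξ : GZIndex n → ℝ} {k l : ℕ} (hk : k + 1 < n)
    (hl : l < k + 1)
    (h : ∀ k' l', k' + 1 < n → l' ≤ k' → ¬ (k' = k ∧ l' = l) →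
      idxDiff ξ k' l' < idxDiff ξ (k' + 1) l')
    (h₀ : idxDiff ξ k l ≤ idxDiff ξ (k + 1) l) :
    rowOffDiag ⟨⟨k + 1, hk⟩, ⟨l, Nat.lt_succ_of_lt hl⟩⟩ ⟨⟨k + 1, hk⟩, ⟨l, Nat.lt_succ_of_lt hl⟩⟩ -
      chartMonomial (mulExponent n k l + conjExponent (mulExponent n k l)) ∈ smallSpan ξ := by
  have hA : chartMonomial (mulExponent n k l) ∈ boundedSpan ξ := by
    refine chartMonomial_mem_laurentSpan ?_
    rw [Set.mem_ofPred_eq, coordWeight_mulExponent]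
    exact sub_nonpos_of_le h₀
  have htop := rowMat_top_mem_smallSpan (ξ := ξ) hk hl
    (fun k' hk' l' _ h' h'' => h k' l' (by omega) h' h'') h₀
  rw [chartMonomial_add, ← star_chartMonomial]
  refine sum_offDiag_sub_mem_smallSpan (F := fun s i p => rowMat p.1.1 _ s i)
    (i₀ := ⟨n - 1 - (k - l + 1), by omega⟩) (s₀ := ⟨n - 1 - (k - l), by omega⟩)
    (by simp only [Fin.lt_def]; omega) hA ?_ ?_
  · have h1 := htop (k - l + 1)
    simp only [if_true] at h1
    simp only [revEntry, show k - l < n by omega, show k - l + 1 < n by omega, and_self,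
      dif_pos] at h1
    exact h1
  · intro i s his hne
    have his' : (i : ℕ) < s := his
    have hs := s.isLt
    -- The row `k - l` in reversed indices is the one adjacent to the minor and carries the leading
    -- entry; rows of smaller index stay small, and those of larger index have no off-diagonal
    -- entries here.
    rcases lt_trichotomy (n - 1 - (s : ℕ)) (k - l) with h1 | h1 | h1
    · have h2 := rowMat_mem_smallSpan_of_le (ξ := ξ) hk (Nat.lt_succ_of_lt hl)
        (b₀ := k - l - 1) (by omega)
        (fun k' hk' l' _ h' => h k' l' (by omega) h' (by omega)) (fun b hb hb' a => ?_)
        (b := n - 1 - s) (by omega) (n - 1 - i)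
      · simpa only [revEntry_rev] using h2
      · by_cases hbk : b = k - l
        · subst hbk
          have h3 := htop a
          have h4 := Submodule.add_mem _ (smallSpan_le_boundedSpan ξ h3)
            (show (if a = k - l + 1 then chartMonomial (mulExponent n k l) else 0) ∈
              boundedSpan ξ by
                split_ifs
                · exact hA
                · exact Submodule.zero_mem _)
          convert h4 using 1
          ext p
          simp only [Pi.add_apply]
          split_ifs <;> simp
        · exact rowMat_mem_boundedSpan_of_mem hk _ (by omega) hb' a
    · have h2 := htop (n - 1 - i)
      have h3 : n - 1 - (i : ℕ) ≠ k - l + 1 := by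
        intro h3
        refine hne ⟨?_, ?_⟩ <;> ext <;> simp only <;> omega
      simp only [h3, if_false, sub_zero] at h2
      rw [← h1] at h2
      simpa only [revEntry_rev] using h2
    · have h2 : (fun p : minorChart n =>
          rowMat p.1.1 ⟨⟨k + 1, hk⟩, ⟨l, Nat.lt_succ_of_lt hl⟩⟩ s i) = 0 :=
        funext fun p => rowMat_apply_eq_zero_or p hk _ his (by omega)
      simp only [h2]
      exact Submodule.zero_mem _

theorem colOffDiag_sub_mem_smallSpan {n : ℕ} {ξ : GZIndex n → ℝ} {k l : ℕ} (hk : k + 1 < n)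
    (hl : l < k + 1)
    (h : ∀ k' l', k' + 1 < n → l' ≤ k' → ¬ (k' = k ∧ l' = l) →
      idxDiff ξ (k' + 1) (l' + 1) < idxDiff ξ k' l')
    (h₀ : idxDiff ξ (k + 1) (l + 1) ≤ idxDiff ξ k l) :
    colOffDiag ⟨⟨k + 1, hk⟩, ⟨l, Nat.lt_succ_of_lt hl⟩⟩ ⟨⟨k + 1, hk⟩, ⟨l, Nat.lt_succ_of_lt hl⟩⟩ -
      chartMonomial (ratioExponent n k l + conjExponent (ratioExponent n k l)) ∈ smallSpan ξ := by
  have hB : -pivotRatio k l ∈ boundedSpan ξ :=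
    Submodule.neg_mem _ (pivotRatio_mem_boundedSpan hk (by omega) h₀)
  have hweak : ∀ k' < k + 1, ∀ l' ≤ k', idxDiff ξ (k' + 1) (l' + 1) ≤ idxDiff ξ k' l' := by
    intro k' hk' l' hl'
    by_cases heq : k' = k ∧ l' = l
    · obtain ⟨rfl, rfl⟩ := heq
      exact h₀
    · exact (h k' l' (by omega) hl' heq).le
  have htop : ∀ {a}, l < a → _ := fun {a} => colMat_top_mem_smallSpan (ξ := ξ) hk hl
    (fun k' hk' => hweak k' (by omega)) (fun k' hk' h' => h k' l (by omega) h' (by omega))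
    (fun k' hk' h' => h k' (l + 1) (by omega) h' (by omega)) (a := a)
  -- The sign of the pivot ratio disappears in the square modulus.
  have hsq : chartMonomial (ratioExponent n k l + conjExponent (ratioExponent n k l)) =
      -pivotRatio k l * star (-pivotRatio k l) := by
    have h1 : star (pivotSign (l + 1) * pivotSign l) = pivotSign (l + 1) * pivotSign l := by
      rw [← starRingEnd_apply, map_mul, conj_pivotSign, conj_pivotSign]
    rw [star_neg, neg_mul_neg, pivotRatio_eq_smul hk (by omega), star_smul, h1,
      smul_mul_smul_comm, mul_mul_mul_comm, pivotSign_mul_self, pivotSign_mul_self, one_mul,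
      one_smul, star_chartMonomial, chartMonomial_add]
  rw [hsq]
  refine sum_offDiag_sub_mem_smallSpan (F := fun s i p => colMat p.1.1 _ s i)
    (i₀ := ⟨n - 1 - (l + 1), by omega⟩) (s₀ := ⟨n - 1 - l, by omega⟩)
    (by simp only [Fin.lt_def]; omega) hB ?_ ?_
  · have h1 := htop (Nat.lt_succ_self l)
    simp only [Nat.succ_eq_add_one, if_true] at h1
    simp only [revEntry, show l < n by omega, show l + 1 < n by omega, and_self,
      dif_pos] at h1
    rw [sub_neg_eq_add]
    exact h1
  · intro i s his hne
    have his' : (i : ℕ) < s := his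
    have hs := s.isLt
    by_cases hz : n - 1 - i ≤ l ∨ l < n - 1 - s
    · have h1 : (fun p : minorChart n =>
          colMat p.1.1 ⟨⟨k + 1, hk⟩, ⟨l, Nat.lt_succ_of_lt hl⟩⟩ s i) = 0 :=
        funext fun p => colMat_apply_eq_zero_or p hk _ his hz
      simp only [h1]
      exact Submodule.zero_mem _
    by_cases hsl : n - 1 - (s : ℕ) = l
    · have h2 := htop (show l < n - 1 - i by omega)
      have h3 : n - 1 - (i : ℕ) ≠ l + 1 := by
        intro h3
        refine hne ⟨?_, ?_⟩ <;> ext <;> simp only <;> omega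
      simp only [h3, if_false, add_zero] at h2
      have h4 : (fun p : minorChart n => revEntry (colMat p.1.1
          ⟨⟨k + 1, hk⟩, ⟨l, Nat.lt_succ_of_lt hl⟩⟩) (n - 1 - s) (n - 1 - i)) ∈ smallSpan ξ := by
        rw [hsl]
        exact h2
      simpa only [revEntry_rev] using h4
    · have h1 := colMat_mem_smallSpan (ξ := ξ) hk (Nat.lt_succ_of_lt hl) hweak (s := n - 1 - s)
        (a := n - 1 - i) (by omega) (by omega) (fun k' hk' h' => h k' _ (by omega) h' (by omega))
      simpa only [revEntry_rev] using h1

/-! ## The linear isomorphism -/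

theorem extendIdx_val {n : ℕ} {M : Type*} [Zero M] (ξ : GZIndex n → M) (c : GZIndex n) :
    extendIdx ξ c.1 c.2 = ξ c :=
  extendIdx_of_lt ξ c.1.isLt c.2.isLt

theorem sum_Iic_eq_sum_range {k : ℕ} (l : Fin (k + 1)) (F : ℕ → ℝ) :
    ∑ i ∈ Finset.Iic l, F i = ∑ i ∈ Finset.range (l + 1), F i := by
  rw [← Nat.Iio_eq_range, show Finset.Iio ((l : ℕ) + 1) = Finset.Iic (l : ℕ) by
    ext; simp, ← Fin.map_valEmbedding_Iic, Finset.sum_map]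
  rfl

/-- Partial sums in the second index. -/
def partialSum {n : ℕ} (lam : GZIndex n → ℝ) (c : GZIndex n) : ℝ :=
  ∑ i ∈ Finset.Iic c.2, lam ⟨c.1, i⟩

theorem extendIdx_partialSum {n : ℕ} (lam : GZIndex n → ℝ) {k l : ℕ} (hk : k < n)
    (hl : l < k + 1) :
    extendIdx (partialSum lam) k l = ∑ i ∈ Finset.range (l + 1), extendIdx lam k i := by
  rw [extendIdx_of_lt _ hk hl, partialSum,
    ← sum_Iic_eq_sum_range (k := k) ⟨l, hl⟩ (fun i => extendIdx lam k i)]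
  exact Finset.sum_congr rfl fun i _ => (extendIdx_val lam ⟨⟨k, hk⟩, i⟩).symm

theorem idxDiff_partialSum {n : ℕ} (lam : GZIndex n → ℝ) {k l : ℕ} (hk : k < n)
    (hl : l < k + 1) : idxDiff (partialSum lam) k l = lam ⟨⟨k, hk⟩, ⟨l, hl⟩⟩ := by
  rw [← extendIdx_of_lt lam hk hl]
  cases l with
  | zero => rw [idxDiff, extendIdx_partialSum lam hk hl, Finset.sum_range_one]
  | succ l =>
    rw [idxDiff, extendIdx_partialSum lam hk hl, extendIdx_partialSum lam hk (by omega),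
      Finset.sum_range_succ _ (l + 1), add_sub_cancel_left]

theorem sum_range_idxDiff {n : ℕ} (ζ : GZIndex n → ℝ) (k l : ℕ) :
    ∑ i ∈ Finset.range (l + 1), idxDiff ζ k i = extendIdx ζ k l := by
  induction l with
  | zero => simp [idxDiff]
  | succ l ih => rw [Finset.sum_range_succ, ih, idxDiff, add_sub_cancel]

/-- Partial sums as a linear automorphism. -/
def partialSumEquiv (n : ℕ) : (GZIndex n → ℝ) ≃ₗ[ℝ] (GZIndex n → ℝ) where
  toFun := partialSum
  invFun ζ c := idxDiff ζ c.1 c.2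
  map_add' a b := by
    ext c
    simp [partialSum, Finset.sum_add_distrib]
  map_smul' a b := by
    ext c
    simp [partialSum, Finset.mul_sum]
  left_inv lam := funext fun c => idxDiff_partialSum lam c.1.isLt c.2.isLt
  right_inv ζ := by
    ext c
    rw [partialSum]
    exact (sum_Iic_eq_sum_range c.2 (fun i => idxDiff ζ c.1 i)).trans
      ((sum_range_idxDiff ζ c.1 c.2).trans (extendIdx_val ζ c))

theorem mem_gzCone_iff {n : ℕ} (lam : GZIndex n → ℝ) :
    lam ∈ gzCone n ↔ RowStrict (partialSum lam) ∧ ColStrict (partialSum lam) := by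
  constructor
  · intro h
    constructor
    · intro k l hk hl
      rw [idxDiff_partialSum lam (by omega) (by omega), idxDiff_partialSum lam hk (by omega)]
      exact (h k hk l (by omega)).1
    · intro k l hk hl
      rw [idxDiff_partialSum lam hk (show l + 1 < k + 1 + 1 by omega),
        idxDiff_partialSum lam (show k < n by omega) (by omega)]
      exact (h k hk l (by omega)).2
  · rintro ⟨h1, h2⟩ a ha b hb
    have h3 := h1 a b ha (by omega)
    have h4 := h2 a b ha (by omega)
    rw [idxDiff_partialSum lam (by omega) (by omega), idxDiff_partialSum lam ha (by omega)] at h3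
    rw [idxDiff_partialSum lam ha (show b + 1 < a + 1 + 1 by omega),
      idxDiff_partialSum lam (show a < n by omega) (by omega)] at h4
    exact ⟨h3, h4⟩

theorem exists_idxDiff_eq (n : ℕ) (F : ℕ → ℕ → ℤ) :
    ∃ ξ : GZIndex n → ℝ, ∀ k l, k < n → l ≤ k → idxDiff ξ k l = F k l :=
  ⟨partialSum fun c => F c.1 c.2, fun k l hk hl => by
    rw [idxDiff_partialSum _ hk (by omega)]⟩

theorem exists_strict (n : ℕ) : ∃ ξ : GZIndex n → ℝ, RowStrict ξ ∧ ColStrict ξ := by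
  -- The pattern `k - 2 l` makes every interlacing gap equal to `1`.
  obtain ⟨ξ, hξ⟩ := exists_idxDiff_eq n fun k l => k - 2 * l
  refine ⟨ξ, fun k l hk hl => ?_, fun k l hk hl => ?_⟩
  · rw [hξ k l (by omega) hl, hξ _ l hk (by omega), Int.cast_lt]
    push_cast
    omega
  · rw [hξ k l (by omega) hl, hξ _ _ hk (by omega), Int.cast_lt]
    push_cast
    omega

theorem exists_row_facet (n k l : ℕ) (hk : k + 1 < n) (hl : l ≤ k) :
    ∃ ξ : GZIndex n → ℝ, ColStrict ξ ∧ (∀ k' l', k' + 1 < n → l' ≤ k' → ¬ (k' = k ∧ l' = l) →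
      idxDiff ξ k' l' < idxDiff ξ (k' + 1) l') ∧ idxDiff ξ k l = idxDiff ξ (k + 1) l := by
  -- All gaps start at `2`. Raising `(k, l)` by one and lowering `(k + 1, l)` by one closes the gap
  -- between them; any other gap involves at most one of the two nodes and stays at least `1`.
  obtain ⟨ξ, hξ⟩ := exists_idxDiff_eq n fun a b => 2 * (a - 2 * b) +
    ((if a = k ∧ b = l then 1 else 0) - if a = k + 1 ∧ b = l then 1 else 0)
  refine ⟨ξ, fun a b ha hb => ?_, fun a b ha hb hab => ?_, ?_⟩
  · rw [hξ a b (by omega) hb, hξ _ _ ha (by omega), Int.cast_lt]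
    push_cast
    split_ifs <;> omega
  · rw [hξ a b (by omega) hb, hξ _ _ ha (by omega), Int.cast_lt]
    push_cast
    split_ifs <;> omega
  · rw [hξ k l (by omega) hl, hξ _ l hk (by omega), Int.cast_inj]
    push_cast
    split_ifs <;> omega

theorem exists_col_facet (n k l : ℕ) (hk : k + 1 < n) (hl : l ≤ k) :
    ∃ ξ : GZIndex n → ℝ, RowStrict ξ ∧ (∀ k' l', k' + 1 < n → l' ≤ k' → ¬ (k' = k ∧ l' = l) →
      idxDiff ξ (k' + 1) (l' + 1) < idxDiff ξ k' l') ∧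
      idxDiff ξ (k + 1) (l + 1) = idxDiff ξ k l := by
  -- The same construction for the gap between `(k, l)` and `(k + 1, l + 1)`.
  obtain ⟨ξ, hξ⟩ := exists_idxDiff_eq n fun a b => 2 * (a - 2 * b) +
    ((if a = k + 1 ∧ b = l + 1 then 1 else 0) - if a = k ∧ b = l then 1 else 0)
  refine ⟨ξ, fun a b ha hb => ?_, fun a b ha hb hab => ?_, ?_⟩
  · rw [hξ a b (by omega) hb, hξ _ _ ha (by omega), Int.cast_lt]
    push_cast
    split_ifs <;> omega
  · rw [hξ a b (by omega) hb, hξ _ _ ha (by omega), Int.cast_lt]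
    push_cast
    split_ifs <;> omega
  · rw [hξ k l (by omega) hl, hξ _ _ hk (by omega), Int.cast_inj]
    push_cast
    split_ifs <;> omega

/-! ## Laurent expansions of brackets -/

theorem eval_eq_linearCombination {n : ℕ} (q : LaurentPoly (Coord (GZIndex n) IsRealIdx))
    (p : minorChart n) :
    q.eval (Coord.val (fun c => solidMinor p.1.1 c)) =
      Finsupp.linearCombination ℂ chartMonomial q.coeff p := by
  rw [LaurentPoly.eval, Finsupp.linearCombination_apply, Finsupp.sum, Finsupp.sum,
    Finset.sum_apply]
  rfl

theorem exists_laurentPoly {n : ℕ} {S : Set (Coord (GZIndex n) IsRealIdx → ℤ)}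
    {φ : minorChart n → ℂ} (h : φ ∈ laurentSpan S) :
    ∃ q : LaurentPoly (Coord (GZIndex n) IsRealIdx),
      Finsupp.linearCombination ℂ chartMonomial q.coeff = φ := by
  obtain ⟨l, -, hl⟩ := (Finsupp.mem_span_image_iff_linearCombination ℂ).mp h
  exact ⟨AddMonoidAlgebra.ofCoeff l, hl⟩

/-- Linear independence reads coefficients off an expansion known only modulo monomials in `S`. The
two explicit terms will be the log-canonical one and the one attached to a facet. -/
theorem coeff_eq_of_notMem {n : ℕ} {S : Set (Coord (GZIndex n) IsRealIdx → ℤ)}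
    {l : (Coord (GZIndex n) IsRealIdx → ℤ) →₀ ℂ}
    {m₀ m₁ : Coord (GZIndex n) IsRealIdx → ℤ} {a b : ℂ}
    (h : Finsupp.linearCombination ℂ chartMonomial l - a • chartMonomial m₀ -
      b • chartMonomial m₁ ∈ laurentSpan S) {m : Coord (GZIndex n) IsRealIdx → ℤ} (hm : m ∉ S) :
    l m = (if m₀ = m then a else 0) + if m₁ = m then b else 0 := by
  classical
  obtain ⟨l', hl', hl⟩ := (Finsupp.mem_span_image_iff_linearCombination ℂ).mp h
  have h1 : l' = l - Finsupp.single m₀ a - Finsupp.single m₁ b := by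
    refine linearIndependent_chartMonomial ?_
    rw [hl, map_sub, map_sub, Finsupp.linearCombination_single, Finsupp.linearCombination_single]
  have h2 : l' m = 0 := by
    by_contra h3
    exact hm ((Finsupp.mem_supported ℂ l').mp hl' (Finsupp.mem_support_iff.mpr h3))
  rw [h1, Finsupp.sub_apply, Finsupp.sub_apply, Finsupp.single_apply, Finsupp.single_apply] at h2
  linear_combination h2

/-- The real bracket of two coordinates as a function on the chart. -/
def chartBracket {n : ℕ} (u v : Coord (GZIndex n) IsRealIdx) : minorChart n → ℂ :=
  fun p => realBracket (coordFun u) (coordFun v) p.1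

theorem chartMonomial_logCanonicalExponent {n : ℕ} (u v : Coord (GZIndex n) IsRealIdx)
    (p : minorChart n) :
    chartMonomial (logCanonicalExponent u v) p =
      Coord.val (fun c => solidMinor p.1.1 c) u * Coord.val (fun c => solidMinor p.1.1 c) v := by
  rw [logCanonicalExponent, chartMonomial_add, Pi.mul_apply, chartMonomial_single,
    chartMonomial_single]

theorem chartBracket_inl_inr {n : ℕ} (c : GZIndex n) (d : {d : GZIndex n // ¬ IsRealIdx d}) :
    chartBracket (Sum.inl c) (Sum.inr d) =
      (Complex.I * mixedConst c d.1) • chartMonomial (logCanonicalExponent (Sum.inl c) (Sum.inr d)) +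
      Complex.I • (chartMonomial (logCanonicalExponent (Sum.inl c) (Sum.inr d)) *
        (colOffDiag c d.1 - rowOffDiag c d.1)) := by
  ext p
  simp only [chartBracket, realBracket, complexBracket_inl_inr, mixed_eq, Pi.add_apply,
    Pi.smul_apply, Pi.mul_apply, Pi.sub_apply, chartMonomial_logCanonicalExponent, Coord.val,
    smul_eq_mul]
  ring

theorem chartBracket_inr_inl {n : ℕ} (c : GZIndex n) (d : {d : GZIndex n // ¬ IsRealIdx d}) :
    chartBracket (Sum.inr d) (Sum.inl c) = -chartBracket (Sum.inl c) (Sum.inr d) := by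
  ext p
  simp only [chartBracket, realBracket, complexBracket_inr_inl, Pi.neg_apply, mul_neg]

theorem logCanonicalExponent_comm {n : ℕ} (u v : Coord (GZIndex n) IsRealIdx) :
    logCanonicalExponent u v = logCanonicalExponent v u :=
  add_comm _ _

theorem monomial_mul_mem_laurentSpan {n : ℕ} {ξ : GZIndex n → ℝ}
    (m₀ : Coord (GZIndex n) IsRealIdx → ℤ) {φ : minorChart n → ℂ} (hφ : φ ∈ smallSpan ξ) :
    chartMonomial m₀ * φ ∈ laurentSpan {m | coordWeight ξ m < coordWeight ξ m₀} :=
  mul_mem_laurentSpan (S := {m₀}) (fun a ha b hb => by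
    rw [Set.mem_singleton_iff.mp ha, Set.mem_ofPred_eq, map_add]
    exact add_lt_of_neg_right _ hb)
    (chartMonomial_mem_laurentSpan (Set.mem_singleton m₀)) hφ

/-- The constant is chosen before the weight, so it is the same for the whole cone. Only the mixed
brackets leave a remainder. -/
theorem exists_chartBracket_sub_mem {n : ℕ} (u v : Coord (GZIndex n) IsRealIdx) :
    ∃ κ : ℂ, ∀ ξ : GZIndex n → ℝ, RowStrict ξ → ColStrict ξ →
      chartBracket u v - κ • chartMonomial (logCanonicalExponent u v) ∈
        laurentSpan {m | coordWeight ξ m < coordWeight ξ (logCanonicalExponent u v)} := by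
  have mixed : ∀ (c : GZIndex n) (d : {d : GZIndex n // ¬ IsRealIdx d}) (ξ : GZIndex n → ℝ),
      RowStrict ξ → ColStrict ξ → chartBracket (Sum.inl c) (Sum.inr d) -
        (Complex.I * mixedConst c d.1) •
          chartMonomial (logCanonicalExponent (Sum.inl c) (Sum.inr d)) ∈
        laurentSpan {m | coordWeight ξ m <
          coordWeight ξ (logCanonicalExponent (Sum.inl c) (Sum.inr d))} := by
    intro c d ξ h1 h2
    rw [chartBracket_inl_inr, add_sub_cancel_left]
    exact Submodule.smul_mem _ _ (monomial_mul_mem_laurentSpan _ (Submodule.sub_mem _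
      (colOffDiag_mem_smallSpan h2 c d.1) (rowOffDiag_mem_smallSpan h1 c d.1)))
  rcases u with c | c <;> rcases v with d | d
  · obtain ⟨κ, hκ⟩ := exists_rForm_sub_eq c d
    refine ⟨Complex.I * κ, fun ξ _ _ => ?_⟩
    have h1 : chartBracket (Sum.inl c) (Sum.inl d) =
        (Complex.I * κ) • chartMonomial (logCanonicalExponent (Sum.inl c) (Sum.inl d)) := by
      ext p
      simp only [chartBracket, realBracket, complexBracket_inl_inl, hκ p, Pi.smul_apply,
        chartMonomial_logCanonicalExponent, Coord.val, smul_eq_mul]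
      ring
    rw [h1, sub_self]
    exact Submodule.zero_mem _
  · exact ⟨_, mixed c d⟩
  · refine ⟨-(Complex.I * mixedConst d c.1), fun ξ h1 h2 => ?_⟩
    rw [chartBracket_inr_inl, logCanonicalExponent_comm, neg_smul, ← neg_sub']
    exact Submodule.neg_mem _ (mixed d c ξ h1 h2)
  · obtain ⟨κ, hκ⟩ := exists_rForm_conjTranspose_sub_eq c.1 d.1
    refine ⟨Complex.I * κ, fun ξ _ _ => ?_⟩
    have h1 : chartBracket (Sum.inr c) (Sum.inr d) =
        (Complex.I * κ) • chartMonomial (logCanonicalExponent (Sum.inr c) (Sum.inr d)) := by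
      ext p
      simp only [chartBracket, realBracket, complexBracket_inr_inr, hκ p, Pi.smul_apply,
        chartMonomial_logCanonicalExponent, Coord.val, smul_eq_mul]
      ring
    rw [h1, sub_self]
    exact Submodule.zero_mem _

theorem isDualGroupLaurentBracket_iff {n : ℕ}
    {P : Coord (GZIndex n) IsRealIdx → Coord (GZIndex n) IsRealIdx →
      LaurentPoly (Coord (GZIndex n) IsRealIdx)} :
    IsDualGroupLaurentBracket n P ↔ ∀ u v,
      Finsupp.linearCombination ℂ chartMonomial (P u v).coeff = chartBracket u v := by
  constructor
  · intro h u v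
    ext p
    rw [← eval_eq_linearCombination, ← h u v p.1 p.2]
    rfl
  · intro h u v p hp
    have h1 := congrFun (h u v) ⟨p, hp⟩
    rw [← eval_eq_linearCombination] at h1
    exact h1.symm

theorem exists_isDualGroupLaurentBracket (n : ℕ) :
    ∃ P, IsDualGroupLaurentBracket n P := by
  -- The weight is auxiliary: a bracket that is small with respect to any weight of the cone is in
  -- particular a Laurent polynomial.
  obtain ⟨ξ, h1, h2⟩ := exists_strict n
  have h : ∀ u v : Coord (GZIndex n) IsRealIdx,
      ∃ q : LaurentPoly (Coord (GZIndex n) IsRealIdx),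
        Finsupp.linearCombination ℂ chartMonomial q.coeff = chartBracket u v := by
    intro u v
    obtain ⟨κ, hκ⟩ := exists_chartBracket_sub_mem u v
    refine exists_laurentPoly (S := Set.univ) ?_
    rw [← sub_add_cancel (chartBracket u v) (κ • chartMonomial (logCanonicalExponent u v))]
    exact Submodule.add_mem _ (laurentSpan_mono (Set.subset_univ _) (hκ ξ h1 h2))
      (Submodule.smul_mem _ _ (chartMonomial_mem_laurentSpan (Set.mem_univ _)))
  choose P hP using h
  exact ⟨P, isDualGroupLaurentBracket_iff.mpr hP⟩

theorem IsDualGroupLaurentBracket.unique {n : ℕ}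
    {P Q : Coord (GZIndex n) IsRealIdx → Coord (GZIndex n) IsRealIdx →
      LaurentPoly (Coord (GZIndex n) IsRealIdx)} (hP : IsDualGroupLaurentBracket n P)
    (hQ : IsDualGroupLaurentBracket n Q) : Q = P := by
  ext1 u
  ext1 v
  have h : (Q u v).coeff = (P u v).coeff := linearIndependent_chartMonomial
    ((isDualGroupLaurentBracket_iff.mp hQ u v).trans
      (isDualGroupLaurentBracket_iff.mp hP u v).symm)
  exact congrArg AddMonoidAlgebra.ofCoeff h

/-! ### The two inclusions between the cones. -/

section

variable {n : ℕ} {P : Coord (GZIndex n) IsRealIdx → Coord (GZIndex n) IsRealIdx →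
      LaurentPoly (Coord (GZIndex n) IsRealIdx)}

theorem mem_tropicalCone_of_strict (hP : IsDualGroupLaurentBracket n P) {ξ : GZIndex n → ℝ}
    (h1 : RowStrict ξ) (h2 : ColStrict ξ) : ξ ∈ tropicalCone P := by
  intro u v m hm hne
  obtain ⟨κ, hκ⟩ := exists_chartBracket_sub_mem u v
  have h3 := hκ ξ h1 h2
  rw [← isDualGroupLaurentBracket_iff.mp hP u v] at h3
  have h3 : Finsupp.linearCombination ℂ chartMonomial (P u v).coeff -
      κ • chartMonomial (logCanonicalExponent u v) - (0 : ℂ) • chartMonomial 0 ∈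
      laurentSpan {m | coordWeight ξ m < coordWeight ξ (logCanonicalExponent u v)} := by
    rwa [zero_smul, sub_zero]
  by_contra h4
  rw [← coordWeight_logCanonicalExponent, ← coordWeight_apply] at h4
  have h5 := coeff_eq_of_notMem h3 (m := m) h4
  rw [if_neg (Ne.symm hne), ite_self, add_zero] at h5
  exact Finsupp.mem_support_iff.mp hm h5

/-- Conjugation preserves weight, so the cone inequality for a square modulus is twice the
inequality for `e`. -/
theorem coordWeight_neg_of_coeff_ne_zero {ξ : GZIndex n → ℝ} (hξ : ξ ∈ tropicalCone P)
    {u v : Coord (GZIndex n) IsRealIdx} {e : Coord (GZIndex n) IsRealIdx → ℤ}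
    (h : (P u v).coeff (logCanonicalExponent u v + (e + conjExponent e)) ≠ 0)
    (hne : e + conjExponent e ≠ 0) : coordWeight ξ e < 0 := by
  have h1 := hξ u v _ (Finsupp.mem_support_iff.mpr h) (by simpa using hne)
  rw [← coordWeight_logCanonicalExponent, ← coordWeight_apply, map_add, map_add,
    coordWeight_conjExponent] at h1
  linarith

theorem add_conjExponent_ne_zero {ξ : GZIndex n → ℝ} {e : Coord (GZIndex n) IsRealIdx → ℤ}
    (h : coordWeight ξ e < 0) : e + conjExponent e ≠ 0 := by
  intro h0
  have h1 := congrArg (coordWeight ξ) h0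
  rw [map_add, coordWeight_conjExponent, map_zero] at h1
  linarith

/-- At a weight where `e` has weight zero, the monomial attached to `e` is as heavy as the
log-canonical one while the remainder is strictly lighter, so nothing can cancel its coefficient `i
b`. -/
theorem coeff_ne_zero_of_facet (hP : IsDualGroupLaurentBracket n P) {c : GZIndex n}
    (hc : ¬ IsRealIdx c) {ξ : GZIndex n → ℝ} {e : Coord (GZIndex n) IsRealIdx → ℤ}
    (he : coordWeight ξ e = 0) (hne : e + conjExponent e ≠ 0) {b : ℂ} (hb : b ≠ 0)
    (h : colOffDiag c c - rowOffDiag c c - b • chartMonomial (e + conjExponent e) ∈ smallSpan ξ) :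
    (P (Sum.inl c) (Sum.inr ⟨c, hc⟩)).coeff
      (logCanonicalExponent (Sum.inl c) (Sum.inr ⟨c, hc⟩) + (e + conjExponent e)) ≠ 0 := by
  set m₀ : Coord (GZIndex n) IsRealIdx → ℤ :=
    logCanonicalExponent (Sum.inl c) (Sum.inr ⟨c, hc⟩) with hm₀
  have h1 : Finsupp.linearCombination ℂ chartMonomial (P (Sum.inl c) (Sum.inr ⟨c, hc⟩)).coeff -
      (Complex.I * mixedConst c c) • chartMonomial m₀ -
      (Complex.I * b) • chartMonomial (m₀ + (e + conjExponent e)) ∈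
      laurentSpan {m | coordWeight ξ m < coordWeight ξ m₀} := by
    rw [isDualGroupLaurentBracket_iff.mp hP, chartBracket_inl_inr, add_sub_cancel_left,
      chartMonomial_add, mul_smul, ← smul_sub, ← mul_smul_comm, ← mul_sub]
    exact Submodule.smul_mem _ _ (monomial_mul_mem_laurentSpan m₀ h)
  have h2 := coeff_eq_of_notMem h1 (m := m₀ + (e + conjExponent e)) (by
    rw [Set.mem_ofPred_eq, map_add, map_add, coordWeight_conjExponent, he]
    simp)
  rw [h2, if_pos rfl, if_neg (by simpa using hne), zero_add]
  exact mul_ne_zero Complex.I_ne_zero hb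

theorem strict_of_mem_tropicalCone (hP : IsDualGroupLaurentBracket n P) {ξ : GZIndex n → ℝ}
    (hξ : ξ ∈ tropicalCone P) : RowStrict ξ ∧ ColStrict ξ := by
  -- This interior weight serves only to show that the square moduli are nontrivial monomials,
  -- distinct from the constant one. The facet weight `ξ₁` cannot do so, since it gives them weight
  -- zero.
  obtain ⟨ξ₀, hr, hc⟩ := exists_strict n
  have hreal : ∀ {k l : ℕ} (hk : k + 1 < n) (hl : l < k + 1),
      ¬ IsRealIdx (⟨⟨k + 1, hk⟩, ⟨l, Nat.lt_succ_of_lt hl⟩⟩ : GZIndex n) :=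
    fun hk hl h => hl.ne h
  constructor
  · intro k l hk hl
    have hl' : l < k + 1 := by omega
    obtain ⟨ξ₁, h1, h2, h3⟩ := exists_row_facet n k l hk hl
    have hne : mulExponent n k l + conjExponent (mulExponent n k l) ≠ 0 :=
      add_conjExponent_ne_zero (ξ := ξ₀) (by
        rw [coordWeight_mulExponent]; exact sub_neg_of_lt (hr k l hk hl))
    have h4 := coordWeight_neg_of_coeff_ne_zero hξ (coeff_ne_zero_of_facet hP (hreal hk hl')
      (ξ := ξ₁) (by rw [coordWeight_mulExponent, h3, sub_self]) hne (b := -1) (by simp) (by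
        have h5 := Submodule.sub_mem _ (colOffDiag_mem_smallSpan h1
          ⟨⟨k + 1, hk⟩, ⟨l, Nat.lt_succ_of_lt hl'⟩⟩ ⟨⟨k + 1, hk⟩, ⟨l, Nat.lt_succ_of_lt hl'⟩⟩)
          (rowOffDiag_sub_mem_smallSpan hk hl' h2 h3.le)
        convert h5 using 1
        rw [neg_one_smul]
        abel)) hne
    rw [coordWeight_mulExponent] at h4
    exact sub_neg.mp h4
  · intro k l hk hl
    have hl' : l < k + 1 := by omega
    obtain ⟨ξ₁, h1, h2, h3⟩ := exists_col_facet n k l hk hl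
    have hne : ratioExponent n k l + conjExponent (ratioExponent n k l) ≠ 0 :=
      add_conjExponent_ne_zero (ξ := ξ₀) (by
        rw [coordWeight_ratioExponent]; exact sub_neg_of_lt (hc k l hk hl))
    have h4 := coordWeight_neg_of_coeff_ne_zero hξ (coeff_ne_zero_of_facet hP (hreal hk hl')
      (ξ := ξ₁) (by rw [coordWeight_ratioExponent, h3, sub_self]) hne (b := 1) (by simp) (by
        have h5 := Submodule.sub_mem _ (colOffDiag_sub_mem_smallSpan hk hl' h2 h3.le)
          (rowOffDiag_mem_smallSpan h1
            ⟨⟨k + 1, hk⟩, ⟨l, Nat.lt_succ_of_lt hl'⟩⟩ ⟨⟨k + 1, hk⟩, ⟨l, Nat.lt_succ_of_lt hl'⟩⟩)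
        convert h5 using 1
        rw [one_smul]
        abel)) hne
    rw [coordWeight_ratioExponent] at h4
    exact sub_neg.mp h4

end

end

theorem mainTheorem2 (n : ℕ) :
    ∃ P : Coord (GZIndex n) IsRealIdx → Coord (GZIndex n) IsRealIdx →
        LaurentPoly (Coord (GZIndex n) IsRealIdx),
      IsDualGroupLaurentBracket n P ∧
      (∀ Q, IsDualGroupLaurentBracket n Q → Q = P) ∧
      ∃ σ : (GZIndex n → ℝ) ≃ₗ[ℝ] (GZIndex n → ℝ),
        (∀ (lam : GZIndex n → ℝ) (k : Fin n) (l : Fin (k.val + 1)),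
          σ lam ⟨k, l⟩ = ∑ i ∈ Finset.Iic l, lam ⟨k, i⟩) ∧
        σ '' gzCone n = tropicalCone P := by
  obtain ⟨P, hP⟩ := exists_isDualGroupLaurentBracket n
  refine ⟨P, hP, fun Q hQ => hP.unique hQ, partialSumEquiv n, fun _ _ _ => rfl, ?_⟩
  ext ξ
  constructor
  · rintro ⟨lam, hlam, rfl⟩
    obtain ⟨h1, h2⟩ := (mem_gzCone_iff lam).mp hlam
    exact mem_tropicalCone_of_strict hP h1 h2
  · intro hξ
    obtain ⟨h1, h2⟩ := strict_of_mem_tropicalCone hP hξ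
    have h3 : partialSum ((partialSumEquiv n).symm ξ) = ξ := (partialSumEquiv n).apply_symm_apply ξ
    exact ⟨(partialSumEquiv n).symm ξ, (mem_gzCone_iff _).mpr (by rw [h3]; exact ⟨h1, h2⟩), h3⟩
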